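/- Let $n$ be a non-negative integer, let $\ell>0$ and $M\ge 0$, and let $Q\subset\mathbb{R}^n$ be a cube of side length $\ell$ parallel to the axes, that is, a translate of $(0,\ell)^n$ or of $[0,\ell]^n$. Let $\mu$ be a probability measure supported on $Q$ with density $e^{-\psi}$ with respect to Lebesgue measure on $Q$, where $\psi:Q\to\mathbb{R}$ is a convex function such that, for every $i=1,\dots,n$, the pure second partial derivative $\partial^{ii}\psi(x)$ exists and satisfies $\partial^{ii}\psi(x)\le M$ at every interior point $x$ of $Q$. Let $A\subseteq\mathbb{R}^n$ be a Borel measurable set with $\mu(A)\ge 1/2$. Then, for all $t>0$, $$\mu(A+tB^n)\ \ge\ 1-\exp\left(-t^2/\alpha^2\right),\qquad \alpha=3\,\ell\,e^{M\ell^2/8},$$ where $B^n=\{x\in\mathbb{R}^n : |x|\le 1\}$ is the closed Euclidean unit ball and $A+tB^n=\{x+ty : x\in A,\ y\in B^n\}$. -/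

import Mathlib

open MeasureTheory
open scoped Pointwise

/-- The open cube of side `ℓ` parallel to the axes with lower corner `a`. -/
def openCube {n : ℕ} (a : EuclideanSpace ℝ (Fin n)) (ℓ : ℝ) : Set (EuclideanSpace ℝ (Fin n)) :=
  {x | ∀ i, x i ∈ Set.Ioo (a i) (a i + ℓ)}

/-- The closed cube of side `ℓ` parallel to the axes with lower corner `a`. -/
def closedCube {n : ℕ} (a : EuclideanSpace ℝ (Fin n)) (ℓ : ℝ) : Set (EuclideanSpace ℝ (Fin n)) :=
  {x | ∀ i, x i ∈ Set.Icc (a i) (a i + ℓ)}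

/-- The first partial derivative of `f` in the `i`-th coordinate direction. -/
noncomputable def partialDeriv {n : ℕ} (i : Fin n) (f : EuclideanSpace ℝ (Fin n) → ℝ)
    (x : EuclideanSpace ℝ (Fin n)) : ℝ :=
  lineDeriv ℝ f x (EuclideanSpace.single i 1)

/-- The pure second partial derivative of `ψ` in the `i`-th coordinate direction exists at `x`
(the existence of the first partial derivative at the neighbouring points of `x` on the line
through `x` in that direction is part of this), and it is at most `M`. -/
def PureSecondDerivLE {n : ℕ} (ψ : EuclideanSpace ℝ (Fin n) → ℝ) (i : Fin n)
    (x : EuclideanSpace ℝ (Fin n)) (M : ℝ) : Prop :=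
  (∀ᶠ s in nhds (0 : ℝ), LineDifferentiableAt ℝ ψ (x + s • EuclideanSpace.single i 1)
    (EuclideanSpace.single i 1)) ∧
  LineDifferentiableAt ℝ (partialDeriv i ψ) x (EuclideanSpace.single i 1) ∧
  partialDeriv i (partialDeriv i ψ) x ≤ M

/-! The core is a Prékopa–Leindler inequality with a quadratic gain: if `f x * g y ≤ exp (c * |x -
y|²) * h ((x + y) / 2)²` on the cube, then `(∫ f) (∫ g) ≤ (∫ h)²`, provided that `h` times a weight
in the `i`-th coordinate, with values in `[1, W]`, is convex in that coordinate for each `i`, and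
`c` is small relative to the side length and `W`. With `h = e^{-ψ}` on the cube, `f = h` on `A` and
`g = e^{ct²} h` on the points at distance at least `t` from `A`, the convexity of `ψ` gives the
hypothesis, and the conclusion bounds `μ(A)` times the mass of the far set by `e^{-ct²}`. The weight
is `e^{Mu²/2}` in centred coordinates: since `∂^{ii}ψ ≤ M`, the function `Mu²/2 - ψ` is convex along
coordinate lines, and so is its exponential; on the cube the weight is at most `W = e^{Mℓ²/8}`.

In dimension one, normalize `f` and `g`, with distribution functions `F` and `G`, and transport by
midpoints: `P(z) = F(z - s(z)) = G(z + s(z))` with `s` 1-Lipschitz and zero at both ends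
(`exists_lipschitz_balance`). Then `P'² ≤ (1 - s'²) f g`, so `P' ≤ (1 - s'²/2) e^{2cs²} h`. The loss
is of order `c ∫ s² h` and the gain is `½ ∫ s'² h`; the Dirichlet–Poincaré inequality
`integral_sq_mul_le_integral_deriv_sq_mul` absorbs the loss, and `1 = ∫ P' ≤ ∫ h`.

The inequality tensorizes (`lintegral_mul_lintegral_le_sq_cube`) because the squared Euclidean
distance is additive over coordinates and weighted convexity survives integration over fibres. Hence
the constant does not depend on the dimension. -/

open Set Filter Topology
open scoped NNReal ENNReal

/-! ### Transport parametrized by midpoints -/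

/-- Two continuous monotone functions can be balanced around every midpoint by a displacement that
is a `1`-Lipschitz function of the midpoint. -/
theorem exists_lipschitz_balance_of_bddBelow {F G : ℝ → ℝ} (hF : Monotone F) (hG : Monotone G)
    (hFc : Continuous F) (hGc : Continuous G)
    (hne : ∀ z, {s | F (z - s) ≤ G (z + s)}.Nonempty)
    (hbdd : ∀ z, BddBelow {s | F (z - s) ≤ G (z + s)}) :
    ∃ s : ℝ → ℝ, LipschitzWith 1 s ∧ (∀ z, F (z - s z) = G (z + s z)) ∧
      ∀ z, IsLeast {s | F (z - s) ≤ G (z + s)} (s z) := by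
  have hclosed : ∀ z, IsClosed {s | F (z - s) ≤ G (z + s)} := fun z =>
    isClosed_le (by fun_prop) (by fun_prop)
  set s : ℝ → ℝ := fun z => sInf {s | F (z - s) ≤ G (z + s)} with hs
  have hleast : ∀ z, IsLeast {s | F (z - s) ≤ G (z + s)} (s z) := fun z =>
    ⟨(hclosed z).csInf_mem (hne z) (hbdd z), fun x hx => csInf_le (hbdd z) hx⟩
  have key : ∀ z z', s z' ≤ s z + |z' - z| := by
    intro z z'
    -- Enlarging `s` by the shift of the midpoint moves the left endpoint left and the right
    -- endpoint right, so monotonicity preserves the inequality.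
    refine (hleast z').2 ?_
    have h1 := (hleast z).1
    simp only [mem_ofPred_eq] at h1 ⊢
    calc F (z' - (s z + |z' - z|)) ≤ F (z - s z) := hF (by linarith [le_abs_self (z' - z)])
      _ ≤ G (z + s z) := h1
      _ ≤ _ := hG (by linarith [neg_abs_le (z' - z)])
  refine ⟨s, ?_, ?_, hleast⟩
  · refine LipschitzWith.of_dist_le_mul fun z z' => ?_
    rw [Real.dist_eq, Real.dist_eq, abs_le]
    have h1 := key z z'
    have h2 := key z' z
    rw [abs_sub_comm z' z] at h1
    simp only [NNReal.coe_one, one_mul]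
    constructor <;> linarith
  · intro z
    refine le_antisymm (hleast z).1 ?_
    -- Below the least element the inequality fails, so its reverse survives in the limit from the
    -- left.
    have ht : Tendsto (fun u => F (z - u) - G (z + u)) (𝓝[<] (s z))
        (𝓝 (F (z - s z) - G (z + s z))) :=
      (Continuous.tendsto (by fun_prop) _).mono_left nhdsWithin_le_nhds
    have : 0 ≤ F (z - s z) - G (z + s z) := by
      refine ge_of_tendsto ht ?_
      filter_upwards [self_mem_nhdsWithin] with u hu
      by_contra hcon
      have : s z ≤ u := (hleast z).2 (by simp only [mem_ofPred_eq]; linarith)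
      exact absurd this (not_le.2 hu)
    linarith

/-- For distribution functions on `[-r, r]` the displacement can also be made to vanish at both
ends, which is the Dirichlet condition of the Poincaré inequality. -/
theorem exists_lipschitz_balance {r : ℝ} {F G : ℝ → ℝ} (hF : Monotone F)
    (hG : Monotone G) (hFc : Continuous F) (hGc : Continuous G)
    (hF0 : ∀ x ≤ -r, F x = 0) (hG0 : ∀ x ≤ -r, G x = 0)
    (hF1 : ∀ x, r ≤ x → F x = 1) (hG1 : ∀ x, r ≤ x → G x = 1) (hr : 0 < r) :
    ∃ s : ℝ → ℝ, LipschitzWith 1 s ∧ s (-r) = 0 ∧ s r = 0 ∧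
      ∀ z ∈ Icc (-r) r, F (z - s z) = G (z + s z) := by
  -- `F` or `G` may be flat near `±r`, and the least displacement there could then be negative.
  -- Adding `e`, zero on `[-r, r]` and strictly increasing on each side of it, forces it to be zero.
  set e : ℝ → ℝ := fun x => min (x + r) 0 + max (x - r) 0 with he
  have hem : Monotone e := fun x y hxy => by
    simp only [he]; gcongr
  have hec : Continuous e := by fun_prop
  have hFle : ∀ x, F x ≤ 1 := fun x => by
    rw [← hF1 (max x r) (le_max_right _ _)]; exact hF (le_max_left _ _)
  have hGle : ∀ x, G x ≤ 1 := fun x => by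
    rw [← hG1 (max x r) (le_max_right _ _)]; exact hG (le_max_left _ _)
  have hFge : ∀ x, 0 ≤ F x := fun x => by
    rw [← hF0 (min x (-r)) (min_le_right _ _)]; exact hF (min_le_left _ _)
  have hGge : ∀ x, 0 ≤ G x := fun x => by
    rw [← hG0 (min x (-r)) (min_le_right _ _)]; exact hG (min_le_left _ _)
  have e1 : ∀ x, x ≤ -r → e x = x + r := fun x hx => by
    simp only [he]; rw [min_eq_left (by linarith), max_eq_right (by linarith)]; ring
  have e2 : ∀ x, r ≤ x → e x = x - r := fun x hx => by
    simp only [he]; rw [min_eq_right (by linarith), max_eq_left (by linarith)]; ring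
  have e3 : ∀ x ∈ Icc (-r) r, e x = 0 := fun x hx => by
    simp only [he]; rw [min_eq_right (by linarith [hx.1]), max_eq_right (by linarith [hx.2])]; ring
  have hne : ∀ z, {s | F (z - s) + e (z - s) ≤ G (z + s) + e (z + s)}.Nonempty := by
    intro z
    refine ⟨|z| + r, ?_⟩
    have h1 := le_abs_self z
    have h2 := neg_abs_le z
    simp only [mem_ofPred_eq]
    rw [e1 _ (by linarith), e2 _ (by linarith)]
    linarith [hF0 (z - (|z| + r)) (by linarith), hGge (z + (|z| + r)), abs_nonneg z]
  have hbdd : ∀ z, BddBelow {s | F (z - s) + e (z - s) ≤ G (z + s) + e (z + s)} := by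
    intro z
    refine ⟨-(|z| + r), fun u hu => ?_⟩
    by_contra hcon
    push Not at hcon
    have h1 := le_abs_self z
    have h2 := neg_abs_le z
    simp only [mem_ofPred_eq] at hu
    rw [e1 (z + u) (by linarith), e2 (z - u) (by linarith)] at hu
    linarith [hF1 (z - u) (by linarith), hGle (z + u), abs_nonneg z]
  obtain ⟨s, hs, heq, hleast⟩ := exists_lipschitz_balance_of_bddBelow
    (F := fun x => F x + e x) (G := fun x => G x + e x) (hF.add hem) (hG.add hem)
    (hFc.add hec) (hGc.add hec) hne hbdd
  have hsr : s (-r) = 0 := by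
    refine le_antisymm ((hleast _).2 ?_) ?_
    · simp [hF0, hG0]
    · by_contra hcon
      push Not at hcon
      have h := (hleast (-r)).1
      simp only [mem_ofPred_eq] at h
      rw [hG0 _ (by linarith), e1 (-r + s (-r)) (by linarith)] at h
      have h1 := hem (show -r ≤ -r - s (-r) by linarith)
      rw [e1 (-r) le_rfl] at h1
      linarith [hFge (-r - s (-r))]
  have hsr' : s r = 0 := by
    refine le_antisymm ((hleast _).2 ?_) ?_
    · simp [hF1, hG1]
    · by_contra hcon
      push Not at hcon
      have h := (hleast r).1
      simp only [mem_ofPred_eq] at h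
      rw [hF1 _ (by linarith), e2 (r - s r) (by linarith)] at h
      have h1 := hem (show r + s r ≤ r by linarith)
      rw [e2 r le_rfl] at h1
      linarith [hGle (r + s r)]
  refine ⟨s, hs, hsr, hsr', fun z hz => ?_⟩
  -- A 1-Lipschitz function vanishing at `±r` keeps `z - s z` and `z + s z` in `[-r, r]`, where `e`
  -- contributes nothing.
  have h1 := hs.dist_le_mul z (-r)
  have h2 := hs.dist_le_mul z r
  rw [Real.dist_eq, Real.dist_eq, hsr, abs_of_nonneg (show 0 ≤ z - -r by linarith [hz.1]),
    abs_le] at h1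
  rw [Real.dist_eq, Real.dist_eq, hsr', abs_of_nonpos (show z - r ≤ 0 by linarith [hz.2]),
    abs_le] at h2
  simp only [NNReal.coe_one, one_mul] at h1 h2
  have h := heq z
  rw [e3 _ ⟨by linarith, by linarith⟩, e3 _ ⟨by linarith, by linarith⟩] at h
  linarith

/-! ### Chain rule inequality and weighted Poincaré inequality -/

/-- The chain rule inequality for a primitive of an upper semicontinuous function. -/
theorem deriv_comp_le_of_upperSemicontinuousAt {F X f : ℝ → ℝ} {z : ℝ}
    (hF : ∀ a b K, a ≤ b → (∀ t ∈ Icc a b, f t ≤ K) → F b - F a ≤ K * (b - a))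
    (hX : Monotone X) (hXd : DifferentiableAt ℝ X z)
    (hPd : DifferentiableAt ℝ (fun t => F (X t)) z) (hf : UpperSemicontinuousAt f (X z)) :
    deriv (fun t => F (X t)) z ≤ deriv X z * f (X z) := by
  have hX0 : 0 ≤ deriv X z := hX.deriv_nonneg
  -- Semicontinuity gives `f < K` near `X z`, so to the right of `z` the function `K * X - F ∘ X`
  -- stays above its value at `z`. `F` itself need not be differentiable at `X z`. Afterwards `K`
  -- decreases to `f (X z)`.
  have key : ∀ K, f (X z) < K → deriv (fun t => F (X t)) z ≤ deriv X z * K := by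
    intro K hK
    obtain ⟨ε, hε, hball⟩ := Metric.eventually_nhds_iff_ball.1 (hf K hK)
    have hev : ∀ᶠ t in 𝓝[>] z, X t ∈ Metric.ball (X z) ε :=
      (hXd.continuousAt.tendsto.mono_left nhdsWithin_le_nhds).eventually (Metric.ball_mem_nhds _ hε)
    have hd : HasDerivAt (fun t => K * X t - F (X t))
        (K * deriv X z - deriv (fun t => F (X t)) z) z :=
      (hXd.hasDerivAt.const_mul K).sub hPd.hasDerivAt
    have ht := (hasDerivWithinAt_iff_tendsto_slope' (s := Ioi z) (by simp)).1
      (hd.hasDerivWithinAt (s := Ioi z))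
    have : 0 ≤ K * deriv X z - deriv (fun t => F (X t)) z := by
      refine ge_of_tendsto ht ?_
      filter_upwards [hev, self_mem_nhdsWithin] with t ht htz
      have htz : z < t := htz
      have hle := hX htz.le
      rw [slope_def_field]
      refine div_nonneg ?_ (by linarith)
      have := hF (X z) (X t) K hle fun u hu => (hball u ?_).le
      · linarith
      · rw [Metric.mem_ball, Real.dist_eq] at ht ⊢
        rw [abs_of_nonneg (by linarith)] at ht
        rw [abs_of_nonneg (by linarith [hu.1])]
        linarith [hu.2]
    linarith
  have ht : Tendsto (fun K => deriv X z * K) (𝓝[>] (f (X z))) (𝓝 (deriv X z * f (X z))) :=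
    (Continuous.tendsto (by fun_prop) _).mono_left nhdsWithin_le_nhds
  refine ge_of_tendsto ht ?_
  filter_upwards [self_mem_nhdsWithin] with K hK using key K hK

/-- The pointwise form of the weighted Dirichlet–Poincaré inequality for a quasi-convex weight. -/
theorem sq_mul_le_integral_deriv_sq_mul {r : ℝ} {s k : ℝ → ℝ} {C : ℝ}
    (hs : LipschitzWith 1 s) (hs0 : s (-r) = 0) (hs1 : s r = 0)
    (hk : Measurable k) (hk0 : ∀ z ∈ Ioo (-r) r, 0 ≤ k z) (hkC : ∀ z ∈ Ioo (-r) r, k z ≤ C)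
    (hq : ∀ x ∈ Ioo (-r) r, ∀ y ∈ Ioo (-r) r, ∀ z ∈ Icc x y, k z ≤ max (k x) (k y))
    {z : ℝ} (hz : z ∈ Ioo (-r) r) :
    s z ^ 2 * k z ≤ 2 * r * ∫ t in -r..r, deriv s t ^ 2 * k t := by
  have hd1 : ∀ t, |deriv s t| ≤ 1 := fun t => by
    have := norm_deriv_le_of_lipschitz (x₀ := t) hs
    simpa using this
  have hdsq : ∀ t, deriv s t ^ 2 ≤ 1 := fun t => by
    rw [sq_le_one_iff_abs_le_one]; exact hd1 t
  have hdi : ∀ a b, IntervalIntegrable (deriv s) volume a b := fun a b => by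
    refine (intervalIntegrable_const (c := (1 : ℝ))).mono_fun
      (measurable_deriv s).aestronglyMeasurable ?_
    exact ae_of_all _ fun t => by simpa using hd1 t
  have hdi2 : ∀ a b, IntervalIntegrable (fun t => deriv s t ^ 2) volume a b := fun a b => by
    refine (intervalIntegrable_const (c := (1 : ℝ))).mono_fun
      ((measurable_deriv s).pow_const 2).aestronglyMeasurable ?_
    exact ae_of_all _ fun t => by simpa using hd1 t
  have hint : IntegrableOn (fun t => deriv s t ^ 2 * k t) (Ioo (-r) r) := by
    refine Measure.integrableOn_of_bounded (M := C) (by simp)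
      (((measurable_deriv s).pow_const 2).mul hk).aestronglyMeasurable ?_
    filter_upwards [ae_restrict_mem measurableSet_Ioo] with t ht
    rw [Real.norm_eq_abs, abs_of_nonneg (mul_nonneg (sq_nonneg _) (hk0 t ht))]
    nlinarith [hdsq t, hk0 t ht, hkC t ht, sq_nonneg (deriv s t)]
  have hftc : ∀ a b, ∫ t in a..b, deriv s t = s b - s a := fun a b =>
    (hs.lipschitzOnWith.absolutelyContinuousOnInterval).integral_deriv_eq_sub
  have hcs : ∀ a b, a ≤ b → (s b - s a) ^ 2 ≤ (b - a) * ∫ t in a..b, deriv s t ^ 2 := by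
    intro a b hab
    rcases hab.eq_or_lt with rfl | hab
    · simp
    set m := (s b - s a) / (b - a) with hm
    have hba : 0 < b - a := by linarith
    -- Cauchy–Schwarz, as nonnegativity of the variance of `s'` about its mean slope `m`.
    have h0 : 0 ≤ ∫ t in a..b, (deriv s t - m) ^ 2 :=
      intervalIntegral.integral_nonneg hab.le fun t _ => sq_nonneg _
    have h1 : ∫ t in a..b, (deriv s t - m) ^ 2 =
        (∫ t in a..b, deriv s t ^ 2) - 2 * m * (s b - s a) + m ^ 2 * (b - a) := by
      have : (fun t => (deriv s t - m) ^ 2) =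
          fun t => (deriv s t ^ 2 - 2 * m * deriv s t) + m ^ 2 := by ext t; ring
      rw [this, intervalIntegral.integral_add ((hdi2 a b).sub ((hdi a b).const_mul _))
        intervalIntegrable_const, intervalIntegral.integral_sub (hdi2 a b) ((hdi a b).const_mul _),
        intervalIntegral.integral_const_mul, hftc, intervalIntegral.integral_const]
      simp only [smul_eq_mul]; ring
    rw [h1] at h0
    have h2 : m * (b - a) = s b - s a := by rw [hm]; field_simp
    have h3 : (∫ t in a..b, deriv s t ^ 2) ≥ m ^ 2 * (b - a) := by
      rw [← h2] at h0; nlinarith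
    calc (s b - s a) ^ 2 = (b - a) * (m ^ 2 * (b - a)) := by rw [← h2]; ring
      _ ≤ _ := by gcongr
  have hmono : ∀ a b, -r ≤ a → a ≤ b → b ≤ r → b - a ≤ 2 * r →
      (∀ t ∈ Ioo a b, k z ≤ k t) → (s b - s a) ^ 2 * k z ≤
      2 * r * ∫ t in -r..r, deriv s t ^ 2 * k t := by
    intro a b ha hab hb hl hkz
    have hnn : ∀ t ∈ Ioo (-r) r, 0 ≤ deriv s t ^ 2 * k t := fun t ht =>
      mul_nonneg (sq_nonneg _) (hk0 t ht)
    have h1 : (∫ t in a..b, deriv s t ^ 2) * k z ≤ ∫ t in -r..r, deriv s t ^ 2 * k t := by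
      rw [← intervalIntegral.integral_mul_const, intervalIntegral.integral_of_le hab,
        intervalIntegral.integral_of_le (by linarith), integral_Ioc_eq_integral_Ioo,
        integral_Ioc_eq_integral_Ioo]
      calc ∫ t in Ioo a b, deriv s t ^ 2 * k z ≤ ∫ t in Ioo a b, deriv s t ^ 2 * k t := by
            refine setIntegral_mono_on ?_ (hint.mono_set (Ioo_subset_Ioo ha hb)) measurableSet_Ioo
              fun t ht => by gcongr; exact hkz t ht
            exact ((intervalIntegrable_iff_integrableOn_Ioo_of_le hab).1 (hdi2 a b)).mul_const _
        _ ≤ _ := by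
            refine setIntegral_mono_set hint ?_ (Ioo_subset_Ioo ha hb).eventuallyLE
            filter_upwards [ae_restrict_mem measurableSet_Ioo] with t ht using hnn t ht
    have h2 : 0 ≤ ∫ t in a..b, deriv s t ^ 2 :=
      intervalIntegral.integral_nonneg hab fun t _ => sq_nonneg _
    calc (s b - s a) ^ 2 * k z ≤ ((b - a) * ∫ t in a..b, deriv s t ^ 2) * k z := by
          gcongr
          · exact hk0 z hz
          · exact hcs a b hab
      _ = (b - a) * ((∫ t in a..b, deriv s t ^ 2) * k z) := by ring
      _ ≤ 2 * r * ((∫ t in a..b, deriv s t ^ 2) * k z) := by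
          gcongr
          exact mul_nonneg h2 (hk0 z hz)
      _ ≤ _ := by
          gcongr
          linarith [hz.1, hz.2]
  -- A quasi-convex `k` cannot drop below `k z` on both sides of `z`. On a side where it does not,
  -- `s` runs from its zero at the endpoint to `s z`, and Cauchy–Schwarz applies with `k z` moved
  -- under the integral.
  by_cases hL : ∀ t ∈ Ioo (-r) z, k z ≤ k t
  · have := hmono (-r) z le_rfl hz.1.le hz.2.le (by linarith [hz.2]) hL
    simpa [hs0] using this
  · have := hmono z r hz.1.le hz.2.le le_rfl (by linarith [hz.1]) ?_
    · simpa [hs1] using this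
    · push Not at hL
      obtain ⟨u, hu, huk⟩ := hL
      intro t ht
      by_contra hcon
      push Not at hcon
      have := hq u ⟨hu.1, hu.2.trans hz.2⟩ t ⟨hz.1.trans ht.1, ht.2⟩ z ⟨hu.2.le, ht.1.le⟩
      exact absurd this (not_le.2 (max_lt huk hcon))

/-- A weighted Poincaré inequality on an interval with Dirichlet boundary conditions, for a density
which is quasi-convex up to a bounded factor `w`. -/
theorem integral_sq_mul_le_integral_deriv_sq_mul {r W C : ℝ} {s h w : ℝ → ℝ} (hr : 0 < r)
    (hs : LipschitzWith 1 s) (hs0 : s (-r) = 0) (hs1 : s r = 0)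
    (hh : Measurable h) (hh0 : ∀ z, 0 ≤ h z) (hhC : ∀ z, h z ≤ C)
    (hw : Measurable w) (hw1 : ∀ z ∈ Ioo (-r) r, 1 ≤ w z) (hwW : ∀ z ∈ Ioo (-r) r, w z ≤ W)
    (hq : ∀ x ∈ Ioo (-r) r, ∀ y ∈ Ioo (-r) r, ∀ z ∈ Icc x y,
      w z * h z ≤ max (w x * h x) (w y * h y)) :
    ∫ z in -r..r, s z ^ 2 * h z ≤ 4 * r ^ 2 * W * ∫ z in -r..r, deriv s z ^ 2 * h z := by
  have hrr : -r ≤ r := by linarith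
  have hW : 0 ≤ W := by
    have h0 : (0 : ℝ) ∈ Ioo (-r) r := ⟨by linarith, hr⟩
    linarith [hw1 0 h0, hwW 0 h0]
  have hdsq : ∀ t, deriv s t ^ 2 ≤ 1 := fun t => by
    rw [sq_le_one_iff_abs_le_one]
    simpa using norm_deriv_le_of_lipschitz (x₀ := t) hs
  have hint : IntegrableOn (fun t => deriv s t ^ 2 * h t) (Ioo (-r) r) := by
    refine Measure.integrableOn_of_bounded (M := C) (by simp)
      (((measurable_deriv s).pow_const 2).mul hh).aestronglyMeasurable ?_
    refine ae_of_all _ fun t => ?_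
    rw [Real.norm_eq_abs, abs_of_nonneg (mul_nonneg (sq_nonneg _) (hh0 t))]
    nlinarith [hdsq t, hh0 t, hhC t, sq_nonneg (deriv s t)]
  have hintw : IntegrableOn (fun t => deriv s t ^ 2 * (w t * h t)) (Ioo (-r) r) := by
    refine Measure.integrableOn_of_bounded (M := W * C) (by simp)
      (((measurable_deriv s).pow_const 2).mul (hw.mul hh)).aestronglyMeasurable ?_
    filter_upwards [ae_restrict_mem measurableSet_Ioo] with t ht
    have h1 := hw1 t ht
    have h2 : w t * h t ≤ W * C := mul_le_mul (hwW t ht) (hhC t) (hh0 t) hW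
    have h3 : 0 ≤ w t * h t := mul_nonneg (by linarith) (hh0 t)
    rw [Real.norm_eq_abs, abs_of_nonneg (mul_nonneg (sq_nonneg _) h3)]
    nlinarith [hdsq t, sq_nonneg (deriv s t)]
  -- The pointwise bound needs the quasi-convex `w * h`; returning to `h` costs `W` on the
  -- derivative side and nothing on the other, as `w ≥ 1`.
  set D := ∫ t in -r..r, deriv s t ^ 2 * (w t * h t) with hD
  have hDle : D ≤ W * ∫ z in -r..r, deriv s z ^ 2 * h z := by
    rw [hD, ← intervalIntegral.integral_const_mul]
    rw [intervalIntegral.integral_of_le hrr, intervalIntegral.integral_of_le hrr,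
      integral_Ioc_eq_integral_Ioo, integral_Ioc_eq_integral_Ioo]
    refine setIntegral_mono_on hintw (hint.const_mul _) measurableSet_Ioo fun t ht => ?_
    have := mul_le_mul_of_nonneg_right (hwW t ht) (mul_nonneg (sq_nonneg (deriv s t)) (hh0 t))
    linarith
  have hpt : ∀ z ∈ Ioo (-r) r, s z ^ 2 * h z ≤ 2 * r * D := by
    intro z hz
    have := sq_mul_le_integral_deriv_sq_mul (k := fun t => w t * h t) (C := W * C) hs hs0 hs1
      (hw.mul hh) (fun t ht => mul_nonneg (by linarith [hw1 t ht]) (hh0 t))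
      (fun t ht => mul_le_mul (hwW t ht) (hhC t) (hh0 t) hW) hq hz
    refine le_trans ?_ this
    have h1 := hw1 z hz
    nlinarith [mul_nonneg (sq_nonneg (s z)) (hh0 z)]
  have hD0 : 0 ≤ 2 * r * D := by
    refine le_trans ?_ (hpt 0 ⟨by linarith, hr⟩)
    exact mul_nonneg (sq_nonneg _) (hh0 0)
  calc ∫ z in -r..r, s z ^ 2 * h z ≤ 2 * r * D * (r - -r) := by
        rw [intervalIntegral.integral_of_le hrr, integral_Ioc_eq_integral_Ioo]
        have hint : IntegrableOn (fun z => s z ^ 2 * h z) (Ioo (-r) r) := by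
          refine Measure.integrableOn_of_bounded (M := 2 * r * D) (by simp)
            ((hs.continuous.measurable.pow_const 2).mul hh).aestronglyMeasurable ?_
          filter_upwards [ae_restrict_mem measurableSet_Ioo] with t ht
          rw [Real.norm_eq_abs, abs_of_nonneg (mul_nonneg (sq_nonneg _) (hh0 t))]
          exact hpt t ht
        refine (setIntegral_mono_on hint (integrableOn_const (by simp)) measurableSet_Ioo
          hpt).trans_eq ?_
        rw [setIntegral_const]
        simp [Measure.real, ENNReal.toReal_ofReal (show 0 ≤ r + r by linarith), mul_comm]
    _ = 4 * r ^ 2 * D := by ring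
    _ ≤ 4 * r ^ 2 * (W * ∫ z in -r..r, deriv s z ^ 2 * h z) := by gcongr
    _ = _ := by ring

/-! ### Three-function inequality on an interval -/

/-- The inequality on an interval for normalized upper semicontinuous functions. -/
theorem one_le_integral_of_upperSemicontinuous {r c W B C : ℝ} {f g h w : ℝ → ℝ} (hr : 0 < r)
    (hc : 0 ≤ c) (hW : 1 ≤ W) (hcr : 18 * c * r ^ 2 * W ≤ 1)
    (hf : UpperSemicontinuous f) (hf0 : ∀ x, 0 ≤ f x) (hfB : ∀ x, f x ≤ B)
    (hfs : ∀ x ∉ Ioo (-r) r, f x = 0) (hfi : ∫ x in -r..r, f x = 1)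
    (hg : UpperSemicontinuous g) (hg0 : ∀ x, 0 ≤ g x) (hgB : ∀ x, g x ≤ B)
    (hgs : ∀ x ∉ Ioo (-r) r, g x = 0) (hgi : ∫ x in -r..r, g x = 1)
    (hh : Measurable h) (hh0 : ∀ z, 0 ≤ h z) (hhC : ∀ z, h z ≤ C)
    (hw : Measurable w) (hw1 : ∀ z ∈ Ioo (-r) r, 1 ≤ w z) (hwW : ∀ z ∈ Ioo (-r) r, w z ≤ W)
    (hq : ∀ x ∈ Ioo (-r) r, ∀ y ∈ Ioo (-r) r, ∀ z ∈ Icc x y,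
      w z * h z ≤ max (w x * h x) (w y * h y))
    (hfgh : ∀ x ∈ Ioo (-r) r, ∀ y ∈ Ioo (-r) r,
      f x * g y ≤ Real.exp (c * (x - y) ^ 2) * h ((x + y) / 2) ^ 2) :
    1 ≤ ∫ z in -r..r, h z := by
  have hrr : -r ≤ r := by linarith
  have hB : 0 ≤ B := (hf0 0).trans (hfB 0)
  have hii : ∀ {φ : ℝ → ℝ}, UpperSemicontinuous φ → (∀ x, 0 ≤ φ x) → (∀ x, φ x ≤ B) →
      ∀ a b, IntervalIntegrable φ volume a b := fun {φ} hφ h0 hB a b => by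
    refine (intervalIntegrable_const (c := B)).mono_fun hφ.measurable.aestronglyMeasurable ?_
    refine ae_of_all _ fun t => ?_
    simp only [Real.norm_eq_abs, abs_of_nonneg (h0 t)]
    exact (hB t).trans (le_abs_self _)
  have prim : ∀ {φ : ℝ → ℝ}, UpperSemicontinuous φ → (∀ x, 0 ≤ φ x) → (∀ x, φ x ≤ B) →
      (∀ x ∉ Ioo (-r) r, φ x = 0) → ∫ x in -r..r, φ x = 1 →
      ∃ F : ℝ → ℝ, Monotone F ∧ LipschitzWith B.toNNReal F ∧ (∀ x ≤ -r, F x = 0) ∧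
        (∀ x, r ≤ x → F x = 1) ∧
        ∀ a b K, a ≤ b → (∀ t ∈ Icc a b, φ t ≤ K) → F b - F a ≤ K * (b - a) := by
    intro φ hφ h0 hφB hs hi
    have hsub : ∀ a b, (∫ x in -r..b, φ x) - ∫ x in -r..a, φ x = ∫ x in a..b, φ x := fun a b =>
      intervalIntegral.integral_interval_sub_left (hii hφ h0 hφB _ _) (hii hφ h0 hφB _ _)
    have hK : ∀ a b K, a ≤ b → (∀ t ∈ Icc a b, φ t ≤ K) →
        (∫ x in -r..b, φ x) - (∫ x in -r..a, φ x) ≤ K * (b - a) := by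
      intro a b K hab hK
      rw [hsub]
      calc ∫ x in a..b, φ x ≤ ∫ x in a..b, K :=
            intervalIntegral.integral_mono_on hab (hii hφ h0 hφB _ _) intervalIntegrable_const hK
        _ = _ := by simp [mul_comm]
    have hm : Monotone fun b => ∫ x in -r..b, φ x := fun a b hab => by
      have := intervalIntegral.integral_nonneg (μ := volume) hab fun t _ => h0 t
      simp only
      linarith [hsub a b]
    refine ⟨fun b => ∫ x in -r..b, φ x, hm, ?_, ?_, ?_, hK⟩
    · refine LipschitzWith.of_le_add_mul _ fun x y => ?_
      rw [Real.coe_toNNReal _ hB, Real.dist_eq]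
      rcases le_total x y with hxy | hxy
      · have := hm hxy
        have := mul_nonneg hB (abs_nonneg (x - y))
        simp only at *
        linarith
      · have := hK y x B hxy fun t _ => hφB t
        rw [abs_of_nonneg (by linarith)]
        linarith
    · intro x hx
      refine intervalIntegral.integral_zero_ae (ae_of_all _ fun t ht => hs t fun ht' => ?_)
      rw [uIoc_of_ge hx] at ht
      linarith [ht.2, ht'.1]
    · intro x hx
      have : ∫ t in r..x, φ t = 0 := by
        refine intervalIntegral.integral_zero_ae (ae_of_all _ fun t ht => hs t fun ht' => ?_)
        rw [uIoc_of_le hx] at ht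
        linarith [ht.1, ht'.2]
      simp only
      linarith [hsub r x]
  obtain ⟨F, hFm, hFl, hF0, hF1, hFK⟩ := prim hf hf0 hfB hfs hfi
  obtain ⟨G, hGm, hGl, hG0, hG1, hGK⟩ := prim hg hg0 hgB hgs hgi
  obtain ⟨s, hs, hs0, hs1, heq⟩ := exists_lipschitz_balance hFm hGm hFl.continuous hGl.continuous
    hF0 hG0 hF1 hG1 hr
  have hsle : ∀ a b, a ≤ b → |s b - s a| ≤ b - a := fun a b hab => by
    have := hs.dist_le_mul b a
    rwa [Real.dist_eq, Real.dist_eq, NNReal.coe_one, one_mul, abs_of_nonneg (sub_nonneg.2 hab)]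
      at this
  have hXm : Monotone fun z => z - s z := fun a b hab => by
    have := abs_le.1 (hsle a b hab); simp only; linarith
  have hYm : Monotone fun z => z + s z := fun a b hab => by
    have := abs_le.1 (hsle a b hab); simp only; linarith
  have hXl : LipschitzWith 2 fun z => z - s z := by
    simpa [one_add_one_eq_two] using LipschitzWith.id.sub hs
  have hYl : LipschitzWith 2 fun z => z + s z := by
    simpa [one_add_one_eq_two] using LipschitzWith.id.add hs
  have hPl := hFl.comp hXl
  have hsr : ∀ z ∈ Icc (-r) r, |s z| ≤ r := fun z hz => by
    have h1 := abs_le.1 (hsle _ _ hz.1)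
    have h2 := abs_le.1 (hsle _ _ hz.2)
    rw [abs_le]; constructor <;> linarith
  have hdsq : ∀ t, deriv s t ^ 2 ≤ 1 := fun t => by
    rw [sq_le_one_iff_abs_le_one]
    simpa using norm_deriv_le_of_lipschitz (x₀ := t) hs
  have hPint : ∫ z in -r..r, deriv (F ∘ fun z => z - s z) z = 1 := by
    rw [(hPl.lipschitzOnWith.absolutelyContinuousOnInterval).integral_deriv_eq_sub]
    simp [hs0, hs1, hF0, hF1]
  -- Bounding `P'` once through `F` and once through `G` and multiplying gives the factor `(1 - s')
  -- (1 + s') = 1 - s'²`, the source of the gain.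
  have hbd : ∀ᵐ z ∂volume.restrict (Ioo (-r) r), deriv (F ∘ fun z => z - s z) z ≤
      h z - 1 / 2 * (deriv s z ^ 2 * h z) + 20 / 9 * c * (s z ^ 2 * h z) := by
    filter_upwards [ae_restrict_mem measurableSet_Ioo,
      ae_restrict_of_ae hs.ae_differentiableAt_real,
      ae_restrict_of_ae hPl.ae_differentiableAt_real] with z hz hsd hPd
    have hXd : HasDerivAt (fun z => z - s z) (1 - deriv s z) z :=
      (hasDerivAt_id z).sub hsd.hasDerivAt
    have hYd : HasDerivAt (fun z => z + s z) (1 + deriv s z) z :=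
      (hasDerivAt_id z).add hsd.hasDerivAt
    have hev : (F ∘ fun z => z - s z) =ᶠ[𝓝 z] fun t => G (t + s t) := by
      filter_upwards [Ioo_mem_nhds hz.1 hz.2] with t ht using heq t (Ioo_subset_Icc_self ht)
    have hP1 : deriv (F ∘ fun z => z - s z) z ≤ (1 - deriv s z) * f (z - s z) := by
      rw [← hXd.deriv]
      exact deriv_comp_le_of_upperSemicontinuousAt hFK hXm hXd.differentiableAt hPd (hf _)
    have hP2 : deriv (F ∘ fun z => z - s z) z ≤ (1 + deriv s z) * g (z + s z) := by
      rw [← hYd.deriv, hev.deriv_eq]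
      exact deriv_comp_le_of_upperSemicontinuousAt hGK hYm hYd.differentiableAt
        (hev.differentiableAt_iff.1 hPd) (hg _)
    have hP0 : 0 ≤ deriv (F ∘ fun z => z - s z) z := (hFm.comp hXm).deriv_nonneg
    set p := deriv (F ∘ fun z => z - s z) z
    set d := deriv s z
    have hd := hdsq z
    have hd' := abs_le.1 ((sq_le_one_iff_abs_le_one _).1 hd)
    have hv : s z ^ 2 ≤ r ^ 2 := sq_le_sq' (by linarith [abs_le.1 (hsr z (Ioo_subset_Icc_self hz))])
      (by linarith [abs_le.1 (hsr z (Ioo_subset_Icc_self hz))])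
    have hv1 : 2 * c * s z ^ 2 ≤ 1 / 9 := by
      have h1 : 2 * c * s z ^ 2 ≤ 2 * c * r ^ 2 := by gcongr
      have h2 : 18 * c * r ^ 2 * 1 ≤ 18 * c * r ^ 2 * W := by gcongr
      linarith
    have hv0 : 0 ≤ 2 * c * s z ^ 2 := by positivity
    -- For `0 ≤ x ≤ 1/9`, `exp x ≤ 1 + x + x² ≤ 1 + 10x/9`; here `x = 2cs²`.
    have hexp : Real.exp (2 * c * s z ^ 2) ≤ 1 + 20 / 9 * c * s z ^ 2 := by
      have := Real.abs_exp_sub_one_sub_id_le (x := 2 * c * s z ^ 2)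
        (by rw [abs_of_nonneg hv0]; linarith)
      have := (abs_le.1 this).2
      nlinarith
    have hsq : p ^ 2 ≤ ((1 - d ^ 2 / 2) * Real.exp (2 * c * s z ^ 2) * h z) ^ 2 := by
      by_cases hx : z - s z ∈ Ioo (-r) r
      · by_cases hy : z + s z ∈ Ioo (-r) r
        · have h1 := hfgh _ hx _ hy
          have e1 : c * (z - s z - (z + s z)) ^ 2 = 2 * c * s z ^ 2 + 2 * c * s z ^ 2 := by ring
          have e2 : (z - s z + (z + s z)) / 2 = z := by ring
          rw [e1, e2, Real.exp_add] at h1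
          set E := Real.exp (2 * c * s z ^ 2)
          calc p ^ 2 = p * p := sq p
            _ ≤ ((1 - d) * f (z - s z)) * ((1 + d) * g (z + s z)) :=
                mul_le_mul hP1 hP2 hP0 (mul_nonneg (by linarith) (hf0 _))
            _ = (1 - d ^ 2) * (f (z - s z) * g (z + s z)) := by ring
            _ ≤ (1 - d ^ 2) * (E * E * h z ^ 2) := by
                gcongr
            _ ≤ (1 - d ^ 2 / 2) ^ 2 * (E * E * h z ^ 2) := by
                gcongr
                nlinarith [sq_nonneg (d ^ 2)]
            _ = _ := by ring
        · rw [hgs _ hy, mul_zero] at hP2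
          rw [le_antisymm hP2 hP0, zero_pow two_ne_zero]; positivity
      · rw [hfs _ hx, mul_zero] at hP1
        rw [le_antisymm hP1 hP0, zero_pow two_ne_zero]; positivity
    have hnn : 0 ≤ (1 - d ^ 2 / 2) * Real.exp (2 * c * s z ^ 2) * h z :=
      mul_nonneg (mul_nonneg (by linarith) (Real.exp_pos _).le) (hh0 z)
    have hple := (abs_le_of_sq_le_sq' hsq hnn).2
    calc p ≤ (1 - d ^ 2 / 2) * Real.exp (2 * c * s z ^ 2) * h z := hple
      _ ≤ (1 - d ^ 2 / 2) * (1 + 20 / 9 * c * s z ^ 2) * h z := by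
          have := hh0 z
          gcongr
          linarith
      _ ≤ (1 - d ^ 2 / 2 + 20 / 9 * c * s z ^ 2) * h z := by
          have := hh0 z
          gcongr
          nlinarith [mul_nonneg (sq_nonneg d) hv0]
      _ = _ := by ring
  have hI : ∀ {φ : ℝ → ℝ} {K : ℝ}, Measurable φ → (∀ z ∈ Ioo (-r) r, |φ z| ≤ K) →
      IntegrableOn φ (Ioo (-r) r) := fun {φ K} hφ hK => by
    refine Measure.integrableOn_of_bounded (M := K) (by simp) hφ.aestronglyMeasurable ?_
    filter_upwards [ae_restrict_mem measurableSet_Ioo] with t ht using hK t ht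
  have i1 : IntegrableOn h (Ioo (-r) r) :=
    hI hh fun z _ => by rw [abs_of_nonneg (hh0 z)]; exact hhC z
  have i2 : IntegrableOn (fun z => deriv s z ^ 2 * h z) (Ioo (-r) r) :=
    hI (((measurable_deriv s).pow_const 2).mul hh) (K := 1 * C) fun z _ => by
      rw [abs_of_nonneg (mul_nonneg (sq_nonneg _) (hh0 z))]
      exact mul_le_mul (hdsq z) (hhC z) (hh0 z) zero_le_one
  have i3 : IntegrableOn (fun z => s z ^ 2 * h z) (Ioo (-r) r) :=
    hI ((hs.continuous.measurable.pow_const 2).mul hh) (K := r ^ 2 * C) fun z hz => by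
      rw [abs_of_nonneg (mul_nonneg (sq_nonneg _) (hh0 z))]
      have := abs_le.1 (hsr z (Ioo_subset_Icc_self hz))
      exact mul_le_mul (sq_le_sq' this.1 this.2) (hhC z) (hh0 z) (sq_nonneg r)
  have hfin := integral_sq_mul_le_integral_deriv_sq_mul hr hs hs0 hs1 hh hh0 hhC hw hw1 hwW hq
  have hPi : IntegrableOn (deriv (F ∘ fun z => z - s z)) (Ioo (-r) r) :=
    hI (measurable_deriv _) fun z _ => by
      simpa using norm_deriv_le_of_lipschitz (x₀ := z) hPl
  rw [intervalIntegral.integral_of_le hrr, integral_Ioc_eq_integral_Ioo] at hPint hfin ⊢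
  rw [intervalIntegral.integral_of_le hrr, integral_Ioc_eq_integral_Ioo] at hfin
  have hD0 : 0 ≤ ∫ z in Ioo (-r) r, deriv s z ^ 2 * h z :=
    integral_nonneg fun z => mul_nonneg (sq_nonneg _) (hh0 z)
  have i4 : IntegrableOn (fun z => h z - 1 / 2 * (deriv s z ^ 2 * h z)) (Ioo (-r) r) :=
    i1.sub (i2.const_mul (1 / 2))
  have hmain := integral_mono_ae hPi (i4.add (i3.const_mul (20 / 9 * c))) hbd
  simp only [Pi.add_apply] at hmain
  rw [hPint, integral_add i4 (i3.const_mul (20 / 9 * c)),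
    integral_sub i1 (i2.const_mul (1 / 2)), integral_const_mul, integral_const_mul] at hmain
  -- The loss is absorbed by the gain because `(20/9) · 4 = (40/81) · 18` and `40/81 ≤ 1/2`.
  have h3 : 20 / 9 * c * ∫ z in Ioo (-r) r, s z ^ 2 * h z ≤
      1 / 2 * ∫ z in Ioo (-r) r, deriv s z ^ 2 * h z := by
    calc _ ≤ 20 / 9 * c * (4 * r ^ 2 * W * ∫ z in Ioo (-r) r, deriv s z ^ 2 * h z) := by gcongr
      _ = 40 / 81 * (18 * c * r ^ 2 * W) * ∫ z in Ioo (-r) r, deriv s z ^ 2 * h z := by ring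
      _ ≤ 40 / 81 * 1 * ∫ z in Ioo (-r) r, deriv s z ^ 2 * h z := by gcongr
      _ ≤ _ := by gcongr; norm_num
  linarith

/-- The inequality on an interval for upper semicontinuous functions. -/
theorem integral_mul_integral_le_sq_of_upperSemicontinuous {r c W B C : ℝ} {f g h w : ℝ → ℝ}
    (hr : 0 < r) (hc : 0 ≤ c) (hW : 1 ≤ W) (hcr : 18 * c * r ^ 2 * W ≤ 1)
    (hf : UpperSemicontinuous f) (hf0 : ∀ x, 0 ≤ f x) (hfB : ∀ x, f x ≤ B)
    (hfs : ∀ x ∉ Ioo (-r) r, f x = 0)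
    (hg : UpperSemicontinuous g) (hg0 : ∀ x, 0 ≤ g x) (hgB : ∀ x, g x ≤ B)
    (hgs : ∀ x ∉ Ioo (-r) r, g x = 0)
    (hh : Measurable h) (hh0 : ∀ z, 0 ≤ h z) (hhC : ∀ z, h z ≤ C)
    (hw : Measurable w) (hw1 : ∀ z ∈ Ioo (-r) r, 1 ≤ w z) (hwW : ∀ z ∈ Ioo (-r) r, w z ≤ W)
    (hq : ∀ x ∈ Ioo (-r) r, ∀ y ∈ Ioo (-r) r, ∀ z ∈ Icc x y,
      w z * h z ≤ max (w x * h x) (w y * h y))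
    (hfgh : ∀ x ∈ Ioo (-r) r, ∀ y ∈ Ioo (-r) r,
      f x * g y ≤ Real.exp (c * (x - y) ^ 2) * h ((x + y) / 2) ^ 2) :
    (∫ x in -r..r, f x) * (∫ x in -r..r, g x) ≤ (∫ z in -r..r, h z) ^ 2 := by
  have hrr : -r ≤ r := by linarith
  set a := ∫ x in -r..r, f x with ha
  set b := ∫ x in -r..r, g x with hb
  have ha0 : 0 ≤ a := intervalIntegral.integral_nonneg hrr fun x _ => hf0 x
  have hb0 : 0 ≤ b := intervalIntegral.integral_nonneg hrr fun x _ => hg0 x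
  rcases ha0.eq_or_lt with ha' | ha'
  · rw [← ha', zero_mul]; positivity
  rcases hb0.eq_or_lt with hb' | hb'
  · rw [← hb', mul_zero]; positivity
  have husc : ∀ {φ : ℝ → ℝ} {m : ℝ}, 0 < m → UpperSemicontinuous φ →
      UpperSemicontinuous fun x => φ x / m := fun {φ m} hm hφ =>
    (continuous_id.div_const m).comp_upperSemicontinuous hφ
      fun x y hxy => div_le_div_of_nonneg_right hxy hm.le
  have hq0 : 0 < √(a * b) := Real.sqrt_pos.2 (mul_pos ha' hb')
  -- The hypotheses are homogeneous: dividing `f` by `a` and `g` by `b` matches dividing `h` by `√(a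
  -- * b)`.
  have key := one_le_integral_of_upperSemicontinuous (f := fun x => f x / a) (g := fun x => g x / b)
    (h := fun x => h x / √(a * b)) (B := max (B / a) (B / b)) (C := C / √(a * b)) hr hc hW hcr
    (husc ha' hf) (fun x => div_nonneg (hf0 x) ha0)
    (fun x => le_max_of_le_left (div_le_div_of_nonneg_right (hfB x) ha0))
    (fun x hx => by simp [hfs x hx])
    (by rw [intervalIntegral.integral_div, ← ha, div_self ha'.ne'])
    (husc hb' hg) (fun x => div_nonneg (hg0 x) hb0)
    (fun x => le_max_of_le_right (div_le_div_of_nonneg_right (hgB x) hb0))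
    (fun x hx => by simp [hgs x hx])
    (by rw [intervalIntegral.integral_div, ← hb, div_self hb'.ne'])
    (hh.div_const _) (fun z => div_nonneg (hh0 z) hq0.le)
    (fun z => div_le_div_of_nonneg_right (hhC z) hq0.le) hw hw1 hwW
    (fun x hx y hy z hz => by
      simp only [← mul_div_assoc]
      rw [max_div_div_right hq0.le]
      exact div_le_div_of_nonneg_right (hq x hx y hy z hz) hq0.le)
    (fun x hx y hy => by
      rw [div_mul_div_comm, div_pow, Real.sq_sqrt (mul_nonneg ha0 hb0), ← mul_div_assoc]
      exact div_le_div_of_nonneg_right (hfgh x hx y hy) (mul_nonneg ha0 hb0))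
  rw [intervalIntegral.integral_div, le_div_iff₀ hq0, one_mul] at key
  calc a * b = √(a * b) ^ 2 := (Real.sq_sqrt (mul_nonneg ha0 hb0)).symm
    _ ≤ _ := by gcongr

/-- Vitali–Carathéodory approximation from below. It reduces the three-function inequality to
semicontinuous `f` and `g`, as its hypothesis persists when `f` and `g` decrease. -/
theorem lintegral_eq_iSup_upperSemicontinuous {α : Type*} [TopologicalSpace α] [MeasurableSpace α]
    [BorelSpace α] {μ : Measure α} [μ.WeaklyRegular] (f : α → ℝ≥0) (hf : ∫⁻ x, f x ∂μ ≠ ∞) :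
    ∫⁻ x, f x ∂μ =
      ⨆ φ : {φ : α → ℝ≥0 // UpperSemicontinuous φ ∧ ∀ x, φ x ≤ f x}, ∫⁻ x, φ.1 x ∂μ := by
  refine le_antisymm ?_ (iSup_le fun φ => lintegral_mono fun x =>
    ENNReal.coe_le_coe.2 (φ.2.2 x))
  refine ENNReal.le_of_forall_pos_le_add fun ε hε _ => ?_
  obtain ⟨φ, hle, husc, hint⟩ := exists_upperSemicontinuous_le_lintegral_le f hf
    (ε := (ε : ℝ≥0∞)) (by simpa using hε.ne')
  refine hint.trans ?_
  gcongr
  exact le_iSup (fun φ : {φ : α → ℝ≥0 // UpperSemicontinuous φ ∧ ∀ x, φ x ≤ f x} =>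
    ∫⁻ x, φ.1 x ∂μ) ⟨φ, husc, hle⟩

/-- A three-function inequality of Prékopa–Leindler type on an interval, with a gain which is
quadratic in the distance. -/
theorem lintegral_mul_lintegral_le_sq_Ioo {r c W : ℝ} {C : ℝ≥0∞} {f g h : ℝ → ℝ≥0∞} {w : ℝ → ℝ}
    (hr : 0 < r) (hc : 0 ≤ c) (hW : 1 ≤ W) (hcr : 18 * c * r ^ 2 * W ≤ 1)
    (hh : Measurable h) (hC : C ≠ ∞)
    (hhC : ∀ z ∈ Ioo (-r) r, h z ≤ C)
    (hw : Measurable w) (hw1 : ∀ z ∈ Ioo (-r) r, 1 ≤ w z) (hwW : ∀ z ∈ Ioo (-r) r, w z ≤ W)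
    (hconv : ∀ x ∈ Ioo (-r) r, ∀ y ∈ Ioo (-r) r, ∀ a b : ℝ, 0 ≤ a → 0 ≤ b → a + b = 1 →
      ENNReal.ofReal (w (a * x + b * y)) * h (a * x + b * y) ≤
        ENNReal.ofReal a * (ENNReal.ofReal (w x) * h x) +
          ENNReal.ofReal b * (ENNReal.ofReal (w y) * h y))
    (hfgh : ∀ x ∈ Ioo (-r) r, ∀ y ∈ Ioo (-r) r,
      f x * g y ≤ ENNReal.ofReal (Real.exp (c * (x - y) ^ 2)) * h ((x + y) / 2) ^ 2) :
    (∫⁻ x in Ioo (-r) r, f x) * (∫⁻ x in Ioo (-r) r, g x) ≤ (∫⁻ z in Ioo (-r) r, h z) ^ 2 := by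
  have hrr : -r ≤ r := by linarith
  have hmid : ∀ x ∈ Ioo (-r) r, ∀ y ∈ Ioo (-r) r, (x + y) / 2 ∈ Ioo (-r) r := fun x hx y hy =>
    ⟨by linarith [hx.1, hy.1], by linarith [hx.2, hy.2]⟩
  set K : ℝ≥0∞ := ENNReal.ofReal (Real.exp (c * (2 * r) ^ 2)) * C ^ 2 with hK
  have hKtop : K ≠ ∞ := ENNReal.mul_ne_top ENNReal.ofReal_ne_top (ENNReal.pow_ne_top hC)
  have hfgK : ∀ x ∈ Ioo (-r) r, ∀ y ∈ Ioo (-r) r, f x * g y ≤ K := fun x hx y hy => by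
    refine (hfgh x hx y hy).trans ?_
    have h1 : (x - y) ^ 2 ≤ (2 * r) ^ 2 :=
      sq_le_sq' (by linarith [hx.1, hy.2]) (by linarith [hx.2, hy.1])
    exact mul_le_mul' (ENNReal.ofReal_le_ofReal (Real.exp_le_exp.2 (by gcongr)))
      (pow_le_pow_left' (hhC _ (hmid x hx y hy)) 2)
  by_cases hf0 : ∫⁻ x in Ioo (-r) r, f x = 0
  · simp [hf0]
  by_cases hg0 : ∫⁻ x in Ioo (-r) r, g x = 0
  · simp [hg0]
  have hex : ∀ {φ : ℝ → ℝ≥0∞}, (∫⁻ x in Ioo (-r) r, φ x ≠ 0) → ∃ x ∈ Ioo (-r) r, φ x ≠ 0 := by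
    intro φ hφ
    by_contra hcon
    push Not at hcon
    exact hφ ((setLIntegral_congr_fun measurableSet_Ioo hcon).trans (by simp))
  obtain ⟨x₀, hx₀, hfx₀⟩ := hex hf0
  obtain ⟨y₀, hy₀, hgy₀⟩ := hex hg0
  -- Boundedness comes for free: freezing one point where the other function is nonzero bounds each
  -- of `f`, `g`.
  have hfb : ∀ x ∈ Ioo (-r) r, f x ≤ K / g y₀ := fun x hx =>
    (ENNReal.le_div_iff_mul_le (Or.inl hgy₀) (Or.inr hKtop)).2 (hfgK x hx y₀ hy₀)
  have hgb : ∀ x ∈ Ioo (-r) r, g x ≤ K / f x₀ := fun x hx =>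
    (ENNReal.le_div_iff_mul_le (Or.inl hfx₀) (Or.inr hKtop)).2
      (by rw [mul_comm]; exact hfgK x₀ hx₀ x hx)
  set B : ℝ≥0 := max (K / g y₀).toNNReal (K / f x₀).toNNReal with hB
  have hBf : K / g y₀ ≤ B := by
    rw [← ENNReal.coe_toNNReal (ENNReal.div_ne_top hKtop hgy₀)]
    exact_mod_cast le_max_left _ _
  have hBg : K / f x₀ ≤ B := by
    rw [← ENNReal.coe_toNNReal (ENNReal.div_ne_top hKtop hfx₀)]
    exact_mod_cast le_max_right _ _
  have hbound : ∀ {φ : ℝ → ℝ≥0∞}, (∀ x ∈ Ioo (-r) r, φ x ≤ B) →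
      ∃ φ₀ : ℝ → ℝ≥0, (∀ x, φ₀ x ≤ B) ∧ (∀ x ∉ Ioo (-r) r, φ₀ x = 0) ∧
        (∀ x ∈ Ioo (-r) r, (φ₀ x : ℝ≥0∞) = φ x) ∧
        ∫⁻ x in Ioo (-r) r, φ x = ∫⁻ x in Ioo (-r) r, (φ₀ x : ℝ≥0∞) := by
    intro φ hφ
    have h3 : ∀ x ∈ Ioo (-r) r, (((Ioo (-r) r).indicator (fun x => (φ x).toNNReal) x : ℝ≥0) : ℝ≥0∞)
        = φ x := fun x hx => by
      rw [indicator_of_mem hx, ENNReal.coe_toNNReal (ne_top_of_le_ne_top ENNReal.coe_ne_top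
        (hφ x hx))]
    refine ⟨(Ioo (-r) r).indicator fun x => (φ x).toNNReal, fun x => ?_,
      fun x hx => indicator_of_notMem hx _, h3,
      setLIntegral_congr_fun measurableSet_Ioo fun x hx => (h3 x hx).symm⟩
    by_cases hx : x ∈ Ioo (-r) r
    · have := hφ x hx
      rw [← h3 x hx] at this
      exact_mod_cast this
    · rw [indicator_of_notMem hx]; exact zero_le
  obtain ⟨f₀, hf₀B, hf₀s, hf₀, hf₀i⟩ := hbound fun x hx => (hfb x hx).trans hBf
  obtain ⟨g₀, hg₀B, hg₀s, hg₀, hg₀i⟩ := hbound fun x hx => (hgb x hx).trans hBg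
  have hfin : ∀ {φ : ℝ → ℝ≥0}, (∀ x, φ x ≤ B) → ∫⁻ x in Ioo (-r) r, (φ x : ℝ≥0∞) ≠ ∞ := by
    intro φ hφ
    refine ne_top_of_le_ne_top ?_ (setLIntegral_mono measurable_const
      fun x _ => ENNReal.coe_le_coe.2 (hφ x))
    rw [setLIntegral_const]
    exact ENNReal.mul_ne_top ENNReal.coe_ne_top (by simp)
  rw [hf₀i, hg₀i, lintegral_eq_iSup_upperSemicontinuous f₀ (hfin hf₀B),
    lintegral_eq_iSup_upperSemicontinuous g₀ (hfin hg₀B), ENNReal.iSup_mul]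
  refine iSup_le fun ⟨φ, hφ, hφf⟩ => ?_
  rw [ENNReal.mul_iSup]
  refine iSup_le fun ⟨γ, hγ, hγg⟩ => ?_
  simp only
  set h₀ : ℝ → ℝ := (Ioo (-r) r).indicator fun z => (h z).toReal with hh₀
  have hmem : ∀ z ∈ Ioo (-r) r, h₀ z = (h z).toReal := fun z hz => indicator_of_mem hz _
  have hht : ∀ z ∈ Ioo (-r) r, h z ≠ ∞ := fun z hz => ne_top_of_le_ne_top hC (hhC z hz)
  have hh₀0 : ∀ z, 0 ≤ h₀ z := fun z => indicator_nonneg (fun _ _ => ENNReal.toReal_nonneg) _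
  have hh₀C : ∀ z, h₀ z ≤ C.toReal := fun z => by
    by_cases hz : z ∈ Ioo (-r) r
    · rw [hmem z hz]; exact ENNReal.toReal_mono hC (hhC z hz)
    · rw [hh₀, indicator_of_notMem hz]; exact ENNReal.toReal_nonneg
  have hh₀m : Measurable h₀ := hh.ennreal_toReal.indicator measurableSet_Ioo
  have hcoe : ∀ {φ : ℝ → ℝ≥0}, UpperSemicontinuous φ →
      UpperSemicontinuous fun x => (φ x : ℝ) := fun {φ} hφ =>
    NNReal.continuous_coe.comp_upperSemicontinuous hφ NNReal.coe_mono
  have key := integral_mul_integral_le_sq_of_upperSemicontinuous (f := fun x => (φ x : ℝ))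
    (g := fun x => (γ x : ℝ)) (h := h₀) (w := w) (B := B) (C := C.toReal) hr hc hW hcr
    (hcoe hφ) (fun x => (φ x).2) (fun x => NNReal.coe_le_coe.2 ((hφf x).trans (hf₀B x)))
    (fun x hx => by
      rw [le_antisymm ((hφf x).trans_eq (hf₀s x hx)) zero_le, NNReal.coe_zero])
    (hcoe hγ) (fun x => (γ x).2) (fun x => NNReal.coe_le_coe.2 ((hγg x).trans (hg₀B x)))
    (fun x hx => by
      rw [le_antisymm ((hγg x).trans_eq (hg₀s x hx)) zero_le, NNReal.coe_zero])
    hh₀m hh₀0 hh₀C hw hw1 hwW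
    (by
      intro x hx y hy z hz
      have hzm : z ∈ Ioo (-r) r := ⟨hx.1.trans_le hz.1, hz.2.trans_lt hy.2⟩
      obtain ⟨a, b, ha, hb, hab, rfl⟩ := (segment_eq_Icc (hz.1.trans hz.2) ▸ hz : z ∈ segment ℝ x y)
      simp only [smul_eq_mul] at hzm ⊢
      have h1 := ENNReal.toReal_mono ?_ (hconv x hx y hy a b ha hb hab)
      · have h1x : 0 ≤ w x := by linarith [hw1 x hx]
        have h1y : 0 ≤ w y := by linarith [hw1 y hy]
        have h1z : 0 ≤ w (a * x + b * y) := by linarith [hw1 _ hzm]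
        rw [ENNReal.toReal_add, ENNReal.toReal_mul, ENNReal.toReal_mul, ENNReal.toReal_mul,
          ENNReal.toReal_mul, ENNReal.toReal_mul, ENNReal.toReal_ofReal h1z,
          ENNReal.toReal_ofReal h1x, ENNReal.toReal_ofReal h1y, ENNReal.toReal_ofReal ha,
          ENNReal.toReal_ofReal hb, ← hmem _ hzm, ← hmem _ hx, ← hmem _ hy] at h1
        · refine h1.trans ?_
          calc _ ≤ a * max (w x * h₀ x) (w y * h₀ y) + b * max (w x * h₀ x) (w y * h₀ y) := by
                gcongr
                · exact le_max_left _ _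
                · exact le_max_right _ _
            _ = _ := by rw [← add_mul, hab, one_mul]
        · exact ENNReal.mul_ne_top ENNReal.ofReal_ne_top
            (ENNReal.mul_ne_top ENNReal.ofReal_ne_top (hht x hx))
        · exact ENNReal.mul_ne_top ENNReal.ofReal_ne_top
            (ENNReal.mul_ne_top ENNReal.ofReal_ne_top (hht y hy))
      · exact ENNReal.add_ne_top.2 ⟨ENNReal.mul_ne_top ENNReal.ofReal_ne_top
            (ENNReal.mul_ne_top ENNReal.ofReal_ne_top (hht x hx)),
            ENNReal.mul_ne_top ENNReal.ofReal_ne_top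
            (ENNReal.mul_ne_top ENNReal.ofReal_ne_top (hht y hy))⟩)
    (by
      intro x hx y hy
      have hm := hmid x hx y hy
      have h1 : (φ x : ℝ≥0∞) * γ y ≤
          ENNReal.ofReal (Real.exp (c * (x - y) ^ 2)) * h ((x + y) / 2) ^ 2 := by
        refine le_trans ?_ (hfgh x hx y hy)
        rw [← hf₀ x hx, ← hg₀ y hy]
        exact mul_le_mul' (ENNReal.coe_le_coe.2 (hφf x)) (ENNReal.coe_le_coe.2 (hγg y))
      have h2 := ENNReal.toReal_mono (ENNReal.mul_ne_top ENNReal.ofReal_ne_top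
        (ENNReal.pow_ne_top (hht _ hm))) h1
      rwa [ENNReal.toReal_mul, ENNReal.toReal_mul, ENNReal.toReal_pow,
        ENNReal.toReal_ofReal (Real.exp_pos _).le, ← hmem _ hm] at h2)
  have hto : ∀ {φ : ℝ → ℝ≥0}, Measurable φ → (∀ x, φ x ≤ B) →
      ∫⁻ x in Ioo (-r) r, (φ x : ℝ≥0∞) = ENNReal.ofReal (∫ x in -r..r, (φ x : ℝ)) := by
    intro φ hφ hφB
    rw [intervalIntegral.integral_of_le hrr, integral_Ioc_eq_integral_Ioo,
      ofReal_integral_eq_lintegral_ofReal]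
    · simp
    · refine Measure.integrableOn_of_bounded (M := B) (by simp)
        hφ.coe_nnreal_real.aestronglyMeasurable (ae_of_all _ fun x => ?_)
      rw [Real.norm_eq_abs, NNReal.abs_eq]
      exact NNReal.coe_le_coe.2 (hφB x)
    · exact ae_of_all _ fun x => (φ x).2
  have hhint : ∫⁻ z in Ioo (-r) r, h z = ENNReal.ofReal (∫ z in -r..r, h₀ z) := by
    rw [intervalIntegral.integral_of_le hrr, integral_Ioc_eq_integral_Ioo,
      ofReal_integral_eq_lintegral_ofReal]
    · refine setLIntegral_congr_fun measurableSet_Ioo fun z hz => ?_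
      simp only [hmem z hz]
      rw [ENNReal.ofReal_toReal (hht z hz)]
    · refine Measure.integrableOn_of_bounded (M := C.toReal) (by simp)
        hh₀m.aestronglyMeasurable (ae_of_all _ fun x => ?_)
      rw [Real.norm_eq_abs, abs_of_nonneg (hh₀0 x)]
      exact hh₀C x
    · exact ae_of_all _ hh₀0
  rw [hto hφ.measurable fun x => (hφf x).trans (hf₀B x),
    hto hγ.measurable fun x => (hγg x).trans (hg₀B x), hhint,
    ← ENNReal.ofReal_mul (intervalIntegral.integral_nonneg (μ := volume) hrr
      fun x _ => (φ x).coe_nonneg),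
    ← ENNReal.ofReal_pow (intervalIntegral.integral_nonneg (μ := volume) hrr fun x _ => hh₀0 x)]
  exact ENNReal.ofReal_le_ofReal key

/-! ### Tensorization to the cube -/

theorem lintegral_pi_fin_succ {n : ℕ} {μ : Measure ℝ} [SigmaFinite μ] {f : (Fin (n + 1) → ℝ) → ℝ≥0∞}
    (hf : Measurable f) :
    ∫⁻ x, f x ∂Measure.pi (fun _ : Fin (n + 1) => μ) =
      ∫⁻ t, ∫⁻ x, f (Fin.cons t x) ∂Measure.pi (fun _ : Fin n => μ) ∂μ := by
  have hmp := (measurePreserving_piFinSuccAbove (fun _ : Fin (n + 1) => μ) 0).symm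
  rw [← hmp.lintegral_comp hf, lintegral_prod]
  · simp [MeasurableEquiv.piFinSuccAbove, Fin.insertNthEquiv]
  · exact (hf.comp hmp.measurable).aemeasurable

theorem measurable_fin_cons {n : ℕ} :
    Measurable fun p : ℝ × (Fin n → ℝ) => (Fin.cons p.1 p.2 : Fin (n + 1) → ℝ) := by
  refine measurable_pi_lambda _ fun i => ?_
  refine Fin.cases ?_ (fun j => ?_) i
  · simpa using measurable_fst
  · simpa using (measurable_pi_iff.1 measurable_snd) j

theorem ae_pi_restrict_mem {n : ℕ} {s : Set ℝ} (hs : MeasurableSet s) :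
    ∀ᵐ x ∂Measure.pi (fun _ : Fin n => (volume : Measure ℝ).restrict s), ∀ i, x i ∈ s := by
  rw [← Measure.restrict_pi_pi]
  filter_upwards [ae_restrict_mem (MeasurableSet.univ_pi fun _ => hs)] with x hx i
  exact hx i (mem_univ i)

/-- A three-function inequality of Prékopa–Leindler type on a cube, with a gain which is quadratic
in the Euclidean distance, for a density which is convex in each coordinate up to a bounded
weight. -/
theorem lintegral_mul_lintegral_le_sq_cube {r c W : ℝ} {w : ℝ → ℝ}
    (hr : 0 < r) (hc : 0 ≤ c) (hW : 1 ≤ W) (hcr : 18 * c * r ^ 2 * W ≤ 1)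
    (hw : Measurable w) (hw1 : ∀ z ∈ Ioo (-r) r, 1 ≤ w z) (hwW : ∀ z ∈ Ioo (-r) r, w z ≤ W) :
    ∀ (n : ℕ) {C : ℝ≥0∞} {f g h : (Fin n → ℝ) → ℝ≥0∞},
      Measurable f → Measurable g → Measurable h → C ≠ ∞ →
      (∀ z, (∀ i, z i ∈ Ioo (-r) r) → h z ≤ C) →
      (∀ i, ∀ x, (∀ i, x i ∈ Ioo (-r) r) → ∀ u ∈ Ioo (-r) r, ∀ v ∈ Ioo (-r) r,
        ∀ a b : ℝ, 0 ≤ a → 0 ≤ b → a + b = 1 →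
        ENNReal.ofReal (w (a * u + b * v)) * h (Function.update x i (a * u + b * v)) ≤
          ENNReal.ofReal a * (ENNReal.ofReal (w u) * h (Function.update x i u)) +
            ENNReal.ofReal b * (ENNReal.ofReal (w v) * h (Function.update x i v))) →
      (∀ x, (∀ i, x i ∈ Ioo (-r) r) → ∀ y, (∀ i, y i ∈ Ioo (-r) r) →
        f x * g y ≤ ENNReal.ofReal (Real.exp (c * ∑ i, (x i - y i) ^ 2)) *
          h (fun i => (x i + y i) / 2) ^ 2) →
      (∫⁻ x, f x ∂Measure.pi fun _ => volume.restrict (Ioo (-r) r)) *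
        (∫⁻ x, g x ∂Measure.pi fun _ => volume.restrict (Ioo (-r) r)) ≤
          (∫⁻ x, h x ∂Measure.pi fun _ => volume.restrict (Ioo (-r) r)) ^ 2 := by
  intro n
  induction n with
  | zero =>
    intro C f g h hf hg hh hC hhC hconv hfgh
    have := hfgh default (fun i => i.elim0) default (fun i => i.elim0)
    rw [Measure.pi_of_empty _ default, lintegral_dirac, lintegral_dirac, lintegral_dirac]
    convert this using 1
    simp only [Finset.univ_eq_empty, Finset.sum_empty, mul_zero, Real.exp_zero,
      ENNReal.ofReal_one, one_mul]
    exact congrArg (fun z => h z ^ 2) (Subsingleton.elim _ _)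
  | succ n ih =>
    intro C f g h hf hg hh hC hhC hconv hfgh
    set ν : Measure (Fin n → ℝ) := Measure.pi fun _ => volume.restrict (Ioo (-r) r) with hν
    have hcons : ∀ {φ : (Fin (n + 1) → ℝ) → ℝ≥0∞}, Measurable φ → ∀ t : ℝ,
        Measurable fun x : Fin n → ℝ => φ (Fin.cons t x) := fun hφ t =>
      hφ.comp (measurable_fin_cons.comp measurable_prodMk_left)
    have hmem : ∀ {t : ℝ} {x : Fin n → ℝ}, t ∈ Ioo (-r) r → (∀ i, x i ∈ Ioo (-r) r) →
        ∀ i, (Fin.cons t x : Fin (n + 1) → ℝ) i ∈ Ioo (-r) r := fun ht hx =>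
      Fin.cases (by simpa using ht) fun j => by simpa using hx j
    have hmid : ∀ x ∈ Ioo (-r) r, ∀ y ∈ Ioo (-r) r, (x + y) / 2 ∈ Ioo (-r) r := fun x hx y hy =>
      ⟨by linarith [hx.1, hy.1], by linarith [hx.2, hy.2]⟩
    have hae : ∀ᵐ x ∂ν, ∀ i, x i ∈ Ioo (-r) r := ae_pi_restrict_mem measurableSet_Ioo
    have hνfin : ν univ ≠ ∞ := measure_ne_top _ _
    rw [lintegral_pi_fin_succ hf, lintegral_pi_fin_succ hg, lintegral_pi_fin_succ hh]
    -- The interval inequality is applied to the fibre integrals over the last `n` coordinates; its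
    -- three-function hypothesis is the induction hypothesis on slices.
    refine lintegral_mul_lintegral_le_sq_Ioo (C := C * ν univ) (w := w) hr hc hW hcr
      (hh.comp measurable_fin_cons).lintegral_prod_right' (ENNReal.mul_ne_top hC hνfin) ?_
      hw hw1 hwW ?_ ?_
    · intro z hz
      rw [← lintegral_const]
      exact lintegral_mono_ae (hae.mono fun x hx => hhC _ (hmem hz hx))
    -- This is where convexity is needed: unlike quasi-convexity, it passes to integrals over
    -- fibres.
    · intro u hu v hv a b ha hb hab
      have hz : ∀ t : ℝ, Measurable fun x : Fin n → ℝ => ENNReal.ofReal (w t) * h (Fin.cons t x) :=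
        fun t => (hcons hh t).const_mul _
      rw [← lintegral_const_mul _ (hcons hh _), ← lintegral_const_mul _ (hcons hh _),
        ← lintegral_const_mul _ (hcons hh _), ← lintegral_const_mul _ (hz _),
        ← lintegral_const_mul _ (hz _), ← lintegral_add_left ((hz _).const_mul _)]
      refine lintegral_mono_ae (hae.mono fun x hx => ?_)
      have := hconv 0 (Fin.cons u x) (hmem hu hx) u hu v hv a b ha hb hab
      simpa only [Fin.update_cons_zero] using this
    · intro t ht τ hτ
      -- The part of the gain due to the first coordinate is constant on the slices; its square root
      -- `E` is absorbed into `h`, which enters squared.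
      set E : ℝ≥0∞ := ENNReal.ofReal (Real.exp (c * (t - τ) ^ 2 / 2)) with hE
      have hE2 : ENNReal.ofReal (Real.exp (c * (t - τ) ^ 2)) = E ^ 2 := by
        rw [hE, ← ENNReal.ofReal_pow (Real.exp_pos _).le, ← Real.exp_nat_mul]
        congr 2
        push_cast; ring
      have key := ih (C := E * C) (f := fun x => f (Fin.cons t x)) (g := fun x => g (Fin.cons τ x))
        (h := fun x => E * h (Fin.cons ((t + τ) / 2) x)) (hcons hf t) (hcons hg τ)
        ((hcons hh _).const_mul E) (ENNReal.mul_ne_top ENNReal.ofReal_ne_top hC)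
        (fun z hz => mul_le_mul_right (hhC _ (hmem (hmid t ht τ hτ) hz)) _)
        (by
          intro i x hx u hu v hv a b ha hb hab
          have := hconv i.succ (Fin.cons ((t + τ) / 2) x) (hmem (hmid t ht τ hτ) hx) u hu v hv
            a b ha hb hab
          simp only [← Fin.cons_update] at this
          calc _ = E * (ENNReal.ofReal (w (a * u + b * v)) *
                h (Fin.cons ((t + τ) / 2) (Function.update x i (a * u + b * v)))) := by ring
            _ ≤ _ := mul_le_mul_right this E
            _ = _ := by ring)
        (by
          intro x hx y hy
          have := hfgh (Fin.cons t x) (hmem ht hx) (Fin.cons τ y) (hmem hτ hy)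
          refine this.trans_eq ?_
          have h1 : (fun i => ((Fin.cons t x : Fin (n + 1) → ℝ) i +
              (Fin.cons τ y : Fin (n + 1) → ℝ) i) / 2) =
              (Fin.cons ((t + τ) / 2) fun i => (x i + y i) / 2 : Fin (n + 1) → ℝ) := by
            funext i
            refine Fin.cases ?_ (fun j => ?_) i <;> simp
          rw [h1, Fin.sum_univ_succ]
          simp only [Fin.cons_zero, Fin.cons_succ]
          rw [mul_add, Real.exp_add, ENNReal.ofReal_mul (Real.exp_pos _).le, hE2]
          ring)
      refine key.trans_eq ?_
      rw [lintegral_const_mul _ (hcons hh _), mul_pow, hE2]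

/-! ### Convexity along coordinate lines and centred coordinates on the cube -/

/-- The homothety with centre `x₀` and small ratio `-η` maps `s` into a ball where `ψ < ψ x₀ + 1`;
since `x₀` lies between `x` and its image, a very negative `ψ x` would contradict convexity. This
makes the density `e^{-ψ}` bounded. -/
theorem ConvexOn.exists_le_of_isOpen_of_isBounded {E : Type*} [NormedAddCommGroup E]
    [NormedSpace ℝ E] [FiniteDimensional ℝ E] {s : Set E} {ψ : E → ℝ} (hψ : ConvexOn ℝ s ψ)
    (hs : IsOpen s) (hb : Bornology.IsBounded s) : ∃ K, ∀ x ∈ s, K ≤ ψ x := by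
  rcases s.eq_empty_or_nonempty with rfl | ⟨x₀, hx₀⟩
  · exact ⟨0, by simp⟩
  have hcont : ContinuousAt ψ x₀ := (hψ.continuousOn hs).continuousAt (hs.mem_nhds hx₀)
  have hev : ∀ᶠ y in 𝓝 x₀, y ∈ s ∧ ψ y < ψ x₀ + 1 :=
    (hs.eventually_mem hx₀).and (hcont.eventually (gt_mem_nhds (by linarith)))
  obtain ⟨δ, hδ, hball⟩ := Metric.eventually_nhds_iff_ball.1 hev
  obtain ⟨R, hR, hsR⟩ := hb.subset_ball_lt 0 x₀
  set η := δ / R with hη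
  have hη0 : 0 < η := div_pos hδ hR
  refine ⟨ψ x₀ - 1 / η, fun x hx => ?_⟩
  have hxR : ‖x - x₀‖ < R := by simpa [dist_eq_norm] using hsR hx
  have hy : x₀ - η • (x - x₀) ∈ Metric.ball x₀ δ := by
    rw [Metric.mem_ball, dist_eq_norm, sub_sub_cancel_left, norm_neg, norm_smul, Real.norm_eq_abs,
      abs_of_pos hη0]
    calc η * ‖x - x₀‖ < η * R := by gcongr
      _ = δ := by rw [hη]; field_simp
  obtain ⟨hys, hyK⟩ := hball _ hy
  have h1 : 0 < 1 + η := by linarith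
  have hconv := hψ.2 hx hys (show 0 ≤ η / (1 + η) by positivity)
    (show 0 ≤ 1 / (1 + η) by positivity) (by field_simp; ring)
  have hcomb : (η / (1 + η)) • x + (1 / (1 + η)) • (x₀ - η • (x - x₀)) = x₀ := by
    have e1 : (η / (1 + η)) • x + (1 / (1 + η)) • (x₀ - η • (x - x₀)) =
        (η / (1 + η) - 1 / (1 + η) * η) • x + (1 / (1 + η) * (1 + η)) • x₀ := by module
    rw [e1, one_div_mul_cancel h1.ne', show η / (1 + η) - 1 / (1 + η) * η = 0 by ring]
    simp
  rw [hcomb] at hconv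
  simp only [smul_eq_mul] at hconv
  have h2 : ψ x₀ * (1 + η) ≤ η * ψ x + (ψ x₀ + 1) := by
    calc ψ x₀ * (1 + η) ≤ (η / (1 + η) * ψ x + 1 / (1 + η) * ψ (x₀ - η • (x - x₀))) * (1 + η) := by
          gcongr
      _ = η * ψ x + ψ (x₀ - η • (x - x₀)) := by field_simp
      _ ≤ _ := by linarith
  have h3 : η * (ψ x₀ - 1 / η) ≤ η * ψ x := by
    have : η * (1 / η) = 1 := by field_simp
    rw [mul_sub, this]; linarith
  exact le_of_mul_le_mul_left h3 hη0

theorem LineDifferentiableAt.hasDerivAt_line {E : Type*} [NormedAddCommGroup E] [NormedSpace ℝ E]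
    {f : E → ℝ} {p v : E} {u₀ x₀ : ℝ} (h : LineDifferentiableAt ℝ f (p + (u₀ - x₀) • v) v) :
    HasDerivAt (fun u => f (p + (u - x₀) • v)) (lineDeriv ℝ f (p + (u₀ - x₀) • v) v) u₀ := by
  have h1 : HasDerivAt (fun t => f (p + (u₀ - x₀) • v + t • v))
      (lineDeriv ℝ f (p + (u₀ - x₀) • v) v) (u₀ - u₀) := by
    rw [sub_self]
    exact h.hasLineDerivAt
  have h2 := h1.comp_sub_const u₀ u₀
  refine h2.congr_of_eventuallyEq (Eventually.of_forall fun u => ?_)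
  simp only
  congr 1
  module

theorem isOpen_openCube {n : ℕ} (a : EuclideanSpace ℝ (Fin n)) (ℓ : ℝ) : IsOpen (openCube a ℓ) := by
  have : openCube a ℓ = ⋂ i, (fun x : EuclideanSpace ℝ (Fin n) => x i) ⁻¹' Ioo (a i) (a i + ℓ) := by
    ext x; simp [openCube]
  rw [this]
  exact isOpen_iInter_of_finite fun i => isOpen_Ioo.preimage (by fun_prop)

theorem openCube_subset_closedCube {n : ℕ} (a : EuclideanSpace ℝ (Fin n)) (ℓ : ℝ) :
    openCube a ℓ ⊆ closedCube a ℓ := fun _ hx i => Ioo_subset_Icc_self (hx i)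

theorem convex_openCube {n : ℕ} (a : EuclideanSpace ℝ (Fin n)) (ℓ : ℝ) :
    Convex ℝ (openCube a ℓ) := fun x hx y hy s t hs ht hst i => by
  simpa using convex_Ioo (a i) (a i + ℓ) (hx i) (hy i) hs ht hst

theorem closedCube_eq_preimage {n : ℕ} (a : EuclideanSpace ℝ (Fin n)) (ℓ : ℝ) :
    closedCube a ℓ = WithLp.ofLp ⁻¹' univ.pi fun i => Icc (a i) (a i + ℓ) := by
  ext x; simp only [closedCube, mem_preimage, mem_univ_pi, mem_ofPred_eq]

theorem openCube_eq_preimage {n : ℕ} (a : EuclideanSpace ℝ (Fin n)) (ℓ : ℝ) :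
    openCube a ℓ = WithLp.ofLp ⁻¹' univ.pi fun i => Ioo (a i) (a i + ℓ) := by
  ext x; simp only [openCube, mem_preimage, mem_univ_pi, mem_ofPred_eq]

theorem isBounded_openCube {n : ℕ} (a : EuclideanSpace ℝ (Fin n)) (ℓ : ℝ) :
    Bornology.IsBounded (openCube a ℓ) := by
  have hc : IsCompact (univ.pi fun i => Icc (a i) (a i + ℓ)) :=
    isCompact_univ_pi fun i => isCompact_Icc
  have h := (hc.image (PiLp.continuous_toLp 2 fun _ : Fin n => ℝ)).isBounded
  refine h.subset fun x hx => ⟨WithLp.ofLp x, fun i _ => Ioo_subset_Icc_self (hx i), rfl⟩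

theorem openCube_ae_eq_closedCube {n : ℕ} (a : EuclideanSpace ℝ (Fin n)) (ℓ : ℝ) :
    openCube a ℓ =ᵐ[volume] closedCube a ℓ := by
  rw [closedCube_eq_preimage, openCube_eq_preimage]
  exact (PiLp.volume_preserving_ofLp (Fin n)).quasiMeasurePreserving.preimage_ae_eq
    Measure.pi_Ioo_ae_eq_pi_Icc

/-- The parametrization of a cube by the coordinates relative to its centre. -/
noncomputable def cubeParam {n : ℕ} (a : EuclideanSpace ℝ (Fin n)) (ℓ : ℝ) (x : Fin n → ℝ) :
    EuclideanSpace ℝ (Fin n) :=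
  WithLp.toLp 2 fun i => x i + (a i + ℓ / 2)

theorem cubeParam_apply {n : ℕ} (a : EuclideanSpace ℝ (Fin n)) (ℓ : ℝ) (x : Fin n → ℝ) (i : Fin n) :
    cubeParam a ℓ x i = x i + (a i + ℓ / 2) := rfl

theorem cubeParam_mem_openCube {n : ℕ} {a : EuclideanSpace ℝ (Fin n)} {ℓ : ℝ} {x : Fin n → ℝ} :
    cubeParam a ℓ x ∈ openCube a ℓ ↔ ∀ i, x i ∈ Ioo (-(ℓ / 2)) (ℓ / 2) := by
  refine forall_congr' fun i => ?_
  rw [cubeParam_apply, mem_Ioo, mem_Ioo]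
  constructor <;> rintro ⟨h1, h2⟩ <;> constructor <;> linarith

theorem cubeParam_update {n : ℕ} (a : EuclideanSpace ℝ (Fin n)) (ℓ : ℝ) (x : Fin n → ℝ)
    (i : Fin n) (u : ℝ) : cubeParam a ℓ (Function.update x i u) =
      cubeParam a ℓ x + (u - x i) • EuclideanSpace.single i 1 := by
  ext j
  rcases eq_or_ne j i with rfl | hji
  · simp [cubeParam_apply]; ring
  · simp [cubeParam_apply, hji]

theorem measurePreserving_cubeParam {n : ℕ} (a : EuclideanSpace ℝ (Fin n)) (ℓ : ℝ) :
    MeasurePreserving (cubeParam a ℓ) :=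
  (PiLp.volume_preserving_toLp (Fin n)).comp
    (measurePreserving_add_right volume fun i => a i + ℓ / 2)

theorem setLIntegral_openCube {n : ℕ} (a : EuclideanSpace ℝ (Fin n)) (ℓ : ℝ)
    {φ : EuclideanSpace ℝ (Fin n) → ℝ≥0∞} (hφ : Measurable φ) :
    ∫⁻ x in openCube a ℓ, φ x =
      ∫⁻ x, φ (cubeParam a ℓ x) ∂Measure.pi fun _ => volume.restrict (Ioo (-(ℓ / 2)) (ℓ / 2)) := by
  have hpre : cubeParam a ℓ ⁻¹' openCube a ℓ = univ.pi fun _ => Ioo (-(ℓ / 2)) (ℓ / 2) := by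
    ext x; simp [cubeParam_mem_openCube]
  have h := (measurePreserving_cubeParam a ℓ).restrict_preimage (isOpen_openCube a ℓ).measurableSet
  rw [← h.lintegral_comp hφ, hpre, volume_pi, Measure.restrict_pi_pi]

/-- An upper bound on a pure second partial derivative, as convexity along coordinate lines. -/
theorem convexOn_mul_sq_sub_of_pureSecondDerivLE {n : ℕ} {a : EuclideanSpace ℝ (Fin n)} {ℓ M : ℝ}
    {ψ : EuclideanSpace ℝ (Fin n) → ℝ} {i : Fin n}
    (hψ : ∀ x ∈ openCube a ℓ, PureSecondDerivLE ψ i x M) {x : Fin n → ℝ}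
    (hx : ∀ i, x i ∈ Ioo (-(ℓ / 2)) (ℓ / 2)) :
    ConvexOn ℝ (Ioo (-(ℓ / 2)) (ℓ / 2))
      fun u => M / 2 * u ^ 2 - ψ (cubeParam a ℓ (Function.update x i u)) := by
  have hmem : ∀ u ∈ Ioo (-(ℓ / 2)) (ℓ / 2),
      cubeParam a ℓ x + (u - x i) • EuclideanSpace.single i 1 ∈ openCube a ℓ := by
    intro u hu
    rw [← cubeParam_update, cubeParam_mem_openCube]
    intro j
    rcases eq_or_ne j i with rfl | hji
    · simpa using hu
    · simpa [hji] using hx j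
  simp only [cubeParam_update]
  set p := cubeParam a ℓ x
  set v : EuclideanSpace ℝ (Fin n) := EuclideanSpace.single i 1
  have hd1 : ∀ u ∈ Ioo (-(ℓ / 2)) (ℓ / 2), HasDerivAt
      (fun u => M / 2 * u ^ 2 - ψ (p + (u - x i) • v))
      (M * u - partialDeriv i ψ (p + (u - x i) • v)) u := by
    intro u hu
    have h1 := (hψ _ (hmem u hu)).1.self_of_nhds
    rw [zero_smul, add_zero] at h1
    refine (((hasDerivAt_pow 2 u).const_mul (M / 2)).sub h1.hasDerivAt_line).congr_deriv ?_
    simp only [partialDeriv]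
    push_cast
    ring_nf
    rfl
  have hd2 : ∀ u ∈ Ioo (-(ℓ / 2)) (ℓ / 2), HasDerivAt
      (fun u => M * u - partialDeriv i ψ (p + (u - x i) • v))
      (M * 1 - partialDeriv i (partialDeriv i ψ) (p + (u - x i) • v)) u := fun u hu =>
    ((hasDerivAt_id u).const_mul M).sub (hψ _ (hmem u hu)).2.1.hasDerivAt_line
  refine convexOn_of_hasDerivWithinAt2_nonneg (convex_Ioo _ _)
    (fun u hu => (hd1 u hu).continuousAt.continuousWithinAt)
    (fun u hu => (hd1 u (interior_subset hu)).hasDerivWithinAt)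
    (fun u hu => (hd2 u (interior_subset hu)).hasDerivWithinAt) fun u hu => ?_
  have := (hψ _ (hmem u (interior_subset hu))).2.2
  linarith

/-! ### Separated sets and concentration -/

/-- Separated sets cannot both have large mass under a log-concave density on a cube with bounded
pure second derivatives. -/
theorem setLIntegral_mul_setLIntegral_le_sq {n : ℕ} {ℓ M c t : ℝ} (hℓ : 0 < ℓ) (hM : 0 ≤ M)
    (hc : 0 ≤ c) (hcℓ : 9 * c * ℓ ^ 2 * Real.exp (M * ℓ ^ 2 / 8) ≤ 2) (ht : 0 ≤ t)
    {a : EuclideanSpace ℝ (Fin n)} {ψ : EuclideanSpace ℝ (Fin n) → ℝ}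
    (hψ : ConvexOn ℝ (openCube a ℓ) ψ)
    (hψM : ∀ x ∈ openCube a ℓ, ∀ i : Fin n, PureSecondDerivLE ψ i x M)
    {A B : Set (EuclideanSpace ℝ (Fin n))} (hA : MeasurableSet A) (hB : MeasurableSet B)
    (hAB : ∀ x ∈ A, ∀ y ∈ B, t ≤ dist x y) :
    (∫⁻ x in A ∩ openCube a ℓ, ENNReal.ofReal (Real.exp (-ψ x))) *
      (ENNReal.ofReal (Real.exp (c * t ^ 2)) *
        ∫⁻ x in B ∩ openCube a ℓ, ENNReal.ofReal (Real.exp (-ψ x))) ≤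
      (∫⁻ x in openCube a ℓ, ENNReal.ofReal (Real.exp (-ψ x))) ^ 2 := by
  set U := openCube a ℓ with hU
  have hUm : MeasurableSet U := (isOpen_openCube a ℓ).measurableSet
  set H : EuclideanSpace ℝ (Fin n) → ℝ≥0∞ :=
    U.indicator fun x => ENNReal.ofReal (Real.exp (-ψ x)) with hH
  have hHmem : ∀ x ∈ U, H x = ENNReal.ofReal (Real.exp (-ψ x)) := fun x hx =>
    indicator_of_mem hx _
  have hHm : Measurable H := by
    classical
    have hcont : ContinuousOn (fun x => ENNReal.ofReal (Real.exp (-ψ x))) U :=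
      ENNReal.continuous_ofReal.comp_continuousOn
        (Real.continuous_exp.comp_continuousOn (hψ.continuousOn (isOpen_openCube a ℓ)).neg)
    rw [hH, ← piecewise_eq_indicator]
    exact hcont.measurable_piecewise continuousOn_const hUm
  have hint : ∀ {S : Set (EuclideanSpace ℝ (Fin n))}, MeasurableSet S →
      ∫⁻ x in S ∩ U, ENNReal.ofReal (Real.exp (-ψ x)) = ∫⁻ x in U, S.indicator H x := by
    intro S hS
    rw [lintegral_indicator hS, Measure.restrict_restrict hS]
    exact setLIntegral_congr_fun (hS.inter hUm) fun x hx => (hHmem x hx.2).symm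
  have hintU : ∫⁻ x in U, ENNReal.ofReal (Real.exp (-ψ x)) = ∫⁻ x in U, H x :=
    setLIntegral_congr_fun hUm fun x hx => (hHmem x hx).symm
  rw [hint hA, hint hB, hintU, setLIntegral_openCube a ℓ (hHm.indicator hA),
    setLIntegral_openCube a ℓ (hHm.indicator hB), setLIntegral_openCube a ℓ hHm]
  have hem := (measurePreserving_cubeParam a ℓ).measurable
  rw [← lintegral_const_mul (f := fun x => B.indicator H (cubeParam a ℓ x)) _
    ((hHm.indicator hB).comp hem)]
  obtain ⟨K, hK⟩ := hψ.exists_le_of_isOpen_of_isBounded (isOpen_openCube a ℓ)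
    (isBounded_openCube a ℓ)
  -- With `r = ℓ/2` the smallness condition `18cr²W ≤ 1` becomes `9cℓ²W ≤ 2`, and `|u| ≤ ℓ/2` gives
  -- `Mu²/2 ≤ Mℓ²/8`.
  refine lintegral_mul_lintegral_le_sq_cube (c := c) (W := Real.exp (M * ℓ ^ 2 / 8))
    (w := fun u => Real.exp (M / 2 * u ^ 2)) (half_pos hℓ) hc (Real.one_le_exp (by positivity))
    ?_ (by fun_prop) (fun z _ => Real.one_le_exp (by positivity)) ?_ n
    (C := ENNReal.ofReal (Real.exp (-K)))
    (f := fun x => A.indicator H (cubeParam a ℓ x))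
    (g := fun x => ENNReal.ofReal (Real.exp (c * t ^ 2)) * B.indicator H (cubeParam a ℓ x))
    (h := fun x => H (cubeParam a ℓ x)) ((hHm.indicator hA).comp hem)
    (((hHm.indicator hB).comp hem).const_mul _) (hHm.comp hem) ENNReal.ofReal_ne_top ?_ ?_ ?_
  · calc _ = 9 * c * ℓ ^ 2 * Real.exp (M * ℓ ^ 2 / 8) / 2 := by ring
      _ ≤ 1 := by linarith
  · intro z hz
    have h1 : z ^ 2 ≤ (ℓ / 2) ^ 2 := sq_le_sq' hz.1.le hz.2.le
    refine Real.exp_le_exp.2 ?_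
    calc M / 2 * z ^ 2 ≤ M / 2 * (ℓ / 2) ^ 2 := by gcongr
      _ = _ := by ring
  · intro z hz
    have hz' := cubeParam_mem_openCube (a := a).2 hz
    rw [hHmem _ hz']
    exact ENNReal.ofReal_le_ofReal (Real.exp_le_exp.2 (neg_le_neg (hK _ hz')))
  · intro i x hx u hu v hv α β hα hβ hαβ
    have hmem : ∀ u ∈ Ioo (-(ℓ / 2)) (ℓ / 2), cubeParam a ℓ (Function.update x i u) ∈ U := by
      intro u hu
      rw [hU, cubeParam_mem_openCube]
      intro j
      rcases eq_or_ne j i with rfl | hji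
      · simpa using hu
      · simpa [hji] using hx j
    have hprod : ∀ u ∈ Ioo (-(ℓ / 2)) (ℓ / 2), ENNReal.ofReal (Real.exp (M / 2 * u ^ 2)) *
        H (cubeParam a ℓ (Function.update x i u)) =
        ENNReal.ofReal (Real.exp (M / 2 * u ^ 2 - ψ (cubeParam a ℓ (Function.update x i u)))) := by
      intro u hu
      rw [hHmem _ (hmem u hu), ← ENNReal.ofReal_mul (Real.exp_pos _).le, ← Real.exp_add,
        sub_eq_add_neg]
    have hm : α * u + β * v ∈ Ioo (-(ℓ / 2)) (ℓ / 2) := convex_Ioo _ _ hu hv hα hβ hαβ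
    have hcv := convexOn_mul_sq_sub_of_pureSecondDerivLE (fun y hy => hψM y hy i) hx
    have h1 := hcv.2 hu hv hα hβ hαβ
    have h2 := convexOn_exp.2 (mem_univ (M / 2 * u ^ 2 - ψ (cubeParam a ℓ (Function.update x i u))))
      (mem_univ (M / 2 * v ^ 2 - ψ (cubeParam a ℓ (Function.update x i v)))) hα hβ hαβ
    simp only [smul_eq_mul] at h1 h2
    rw [hprod _ hm, hprod _ hu, hprod _ hv, ← ENNReal.ofReal_mul hα, ← ENNReal.ofReal_mul hβ,
      ← ENNReal.ofReal_add (mul_nonneg hα (Real.exp_pos _).le) (mul_nonneg hβ (Real.exp_pos _).le)]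
    exact ENNReal.ofReal_le_ofReal ((Real.exp_le_exp.2 h1).trans h2)
  · intro x hx y hy
    have hx' := cubeParam_mem_openCube (a := a).2 hx
    have hy' := cubeParam_mem_openCube (a := a).2 hy
    by_cases hxA : cubeParam a ℓ x ∈ A
    · by_cases hyB : cubeParam a ℓ y ∈ B
      · rw [indicator_of_mem hxA, indicator_of_mem hyB]
        have hmid : cubeParam a ℓ (fun i => (x i + y i) / 2) =
            (1 / 2 : ℝ) • cubeParam a ℓ x + (1 / 2 : ℝ) • cubeParam a ℓ y := by
          ext i
          simp [cubeParam_apply]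
          ring
        have hconv := hψ.2 hx' hy' (show (0 : ℝ) ≤ 1 / 2 by norm_num)
          (show (0 : ℝ) ≤ 1 / 2 by norm_num) (by norm_num)
        have hmem := convex_openCube a ℓ hx' hy' (show (0 : ℝ) ≤ 1 / 2 by norm_num)
          (show (0 : ℝ) ≤ 1 / 2 by norm_num) (by norm_num)
        rw [← hmid] at hconv hmem
        simp only [smul_eq_mul] at hconv
        rw [hHmem _ hx', hHmem _ hy', hHmem _ hmem, ← ENNReal.ofReal_pow (Real.exp_pos _).le,
          ← ENNReal.ofReal_mul (Real.exp_pos _).le, ← ENNReal.ofReal_mul (Real.exp_pos _).le,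
          ← ENNReal.ofReal_mul (Real.exp_pos _).le, ← Real.exp_nat_mul, ← Real.exp_add,
          ← Real.exp_add, ← Real.exp_add]
        -- In logarithms: midpoint convexity of `ψ` handles the densities, and `t ≤ |x - y|` pays
        -- for the factor `e^{ct²}`.
        refine ENNReal.ofReal_le_ofReal (Real.exp_le_exp.2 ?_)
        have hd : t ^ 2 ≤ ∑ i, (x i - y i) ^ 2 := by
          have h1 := hAB _ hxA _ hyB
          have h2 : dist (cubeParam a ℓ x) (cubeParam a ℓ y) ^ 2 = ∑ i, (x i - y i) ^ 2 := by
            rw [EuclideanSpace.dist_eq, Real.sq_sqrt (Finset.sum_nonneg fun i _ => sq_nonneg _)]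
            refine Finset.sum_congr rfl fun i _ => ?_
            rw [cubeParam_apply, cubeParam_apply, Real.dist_eq, sq_abs, add_sub_add_right_eq_sub]
          rw [← h2]
          gcongr
        have := mul_le_mul_of_nonneg_left hd hc
        push_cast
        linarith
      · simp [hyB]
    · simp [hxA]

theorem theorem1 (n : ℕ) (ℓ M : ℝ) (hℓ : 0 < ℓ) (hM : 0 ≤ M)
    (a : EuclideanSpace ℝ (Fin n)) (Q : Set (EuclideanSpace ℝ (Fin n)))
    (hQ : Q = openCube a ℓ ∨ Q = closedCube a ℓ)
    (ψ : EuclideanSpace ℝ (Fin n) → ℝ) (hψ : ConvexOn ℝ Q ψ)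
    (hψM : ∀ x ∈ interior Q, ∀ i : Fin n, PureSecondDerivLE ψ i x M)
    (μ : Measure (EuclideanSpace ℝ (Fin n))) [IsProbabilityMeasure μ]
    (hμ : μ = (volume.restrict Q).withDensity (fun x => ENNReal.ofReal (Real.exp (-ψ x))))
    (A : Set (EuclideanSpace ℝ (Fin n))) (hA : MeasurableSet A) (hμA : 1 / 2 ≤ μ.real A)
    (t : ℝ) (ht : 0 < t) :
    1 - Real.exp (-(t ^ 2 / (3 * ℓ * Real.exp (M * ℓ ^ 2 / 8)) ^ 2)) ≤
      μ.real (A + t • Metric.closedBall (0 : EuclideanSpace ℝ (Fin n)) 1) := by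
  have hsub : openCube a ℓ ⊆ Q := by
    rcases hQ with rfl | rfl
    · exact Subset.rfl
    · exact openCube_subset_closedCube a ℓ
  have hae : Q =ᵐ[volume] openCube a ℓ := by
    rcases hQ with rfl | rfl
    · exact EventuallyEq.rfl
    · exact (openCube_ae_eq_closedCube a ℓ).symm
  have hμS : ∀ {S : Set (EuclideanSpace ℝ (Fin n))}, MeasurableSet S →
      μ S = ∫⁻ x in S ∩ openCube a ℓ, ENNReal.ofReal (Real.exp (-ψ x)) := by
    intro S hS
    rw [hμ, withDensity_apply _ hS, Measure.restrict_congr_set hae, Measure.restrict_restrict hS]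
  set W := Real.exp (M * ℓ ^ 2 / 8) with hW
  have hW1 : 1 ≤ W := Real.one_le_exp (by positivity)
  -- The open thickening is measurable, whatever the sumset is, and lies inside it.
  set T := Metric.thickening t A with hT
  have hTm : MeasurableSet T := Metric.isOpen_thickening.measurableSet
  have hTsub : T ⊆ A + t • Metric.closedBall (0 : EuclideanSpace ℝ (Fin n)) 1 := by
    rw [hT, smul_unitClosedBall_of_nonneg ht.le, ← add_ball_zero]
    exact add_subset_add_left Metric.ball_subset_closedBall
  -- Chosen so that `ct²/2 = t²/α²`. The condition on `c` would allow `W` in place of `W²`; the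
  -- difference is covered by `W ≥ 1`.
  set c := 2 / (9 * ℓ ^ 2 * W ^ 2) with hc
  have hc0 : 0 ≤ c := by positivity
  have key := setLIntegral_mul_setLIntegral_le_sq (c := c) (t := t) hℓ hM hc0
    (by
      have h1 : 9 * c * ℓ ^ 2 * W = 2 / W := by rw [hc]; field_simp
      rw [← hW, h1]
      exact div_le_self zero_le_two hW1)
    ht.le (hψ.subset hsub (convex_openCube a ℓ))
    (fun x hx i => hψM x (interior_maximal hsub (isOpen_openCube a ℓ) hx) i) hA hTm.compl
    (by
      intro x hx y hy
      by_contra hcon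
      push Not at hcon
      exact hy (Metric.mem_thickening_iff.2 ⟨x, hx, by rwa [dist_comm]⟩))
  have huniv := hμS MeasurableSet.univ
  rw [univ_inter, measure_univ] at huniv
  rw [← hμS hA, ← hμS hTm.compl, ← huniv, one_pow] at key
  have key' := ENNReal.toReal_mono ENNReal.one_ne_top key
  rw [ENNReal.toReal_mul, ENNReal.toReal_mul, ENNReal.toReal_ofReal (Real.exp_pos _).le,
    ENNReal.toReal_one] at key'
  change μ.real A * (Real.exp (c * t ^ 2) * μ.real Tᶜ) ≤ 1 at key'
  have hcompl : μ.real Tᶜ = 1 - μ.real T := by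
    rw [measureReal_compl hTm, probReal_univ]
  have hAT : μ.real A ≤ μ.real T := measureReal_mono (Metric.self_subset_thickening ht A)
  have hTle : μ.real T ≤ μ.real (A + t • Metric.closedBall (0 : EuclideanSpace ℝ (Fin n)) 1) :=
    measureReal_mono hTsub
  set q := μ.real Tᶜ with hq
  have hq0 : 0 ≤ q := measureReal_nonneg
  have hexp : t ^ 2 / (3 * ℓ * W) ^ 2 = c * t ^ 2 / 2 := by rw [hc]; field_simp; norm_num
  rw [hexp]
  have hle : q ≤ Real.exp (-(c * t ^ 2 / 2)) := by
    refine abs_le_of_sq_le_sq' ?_ (Real.exp_pos _).le |>.2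
    have e1 : Real.exp (-(c * t ^ 2 / 2)) ^ 2 * Real.exp (c * t ^ 2) = 1 := by
      rw [← Real.exp_nat_mul, ← Real.exp_add]
      push_cast
      rw [show 2 * -(c * t ^ 2 / 2) + c * t ^ 2 = 0 by ring, Real.exp_zero]
    -- Since `A ⊆ T`, `q ≤ 1 - μ(A) ≤ 1/2 ≤ μ(A)`. Replacing `μ(A)` by `q` turns the product bound
    -- into `q² e^{ct²} ≤ 1`, which avoids a factor in front of the exponential.
    have hqA : q ≤ μ.real A := by linarith
    have h2 : q ^ 2 * Real.exp (c * t ^ 2) ≤ 1 := by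
      calc q ^ 2 * Real.exp (c * t ^ 2) = q * (Real.exp (c * t ^ 2) * q) := by ring
        _ ≤ μ.real A * (Real.exp (c * t ^ 2) * q) := by gcongr
        _ ≤ 1 := key'
    rw [← e1] at h2
    exact le_of_mul_le_mul_right h2 (Real.exp_pos _)
  linarith
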